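/- Let $n\ge 1$, and let $n$ coins of identical appearance be given, labelled $1,\dots,n$, each of which has one of two distinct positive weights. The two weights are not known, it is not known which coins have which weight, all coins may have the same weight, and no other coins are available. A weighing on a two-pan balance compares the total weights of two disjoint sets of the coins and shows which pan is heavier or that they balance; the choice of a weighing may depend on the outcomes of the earlier ones. To sort the coins means to determine the partition into lighter and heavier coins, or to find that all coins have the same weight (in which case it need not be decided whether this is the smaller or the larger weight). Let $\bar g(n)$ be the least number $k$ such that some weighing procedure sorts the coins with at most $k$ weighings in every case. Then $\bar g(n)$ exists and $$\lceil \log_3(2^n-1)\rceil \le \bar g(n)\le \lceil 7n/11\rceil .$$ -/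

import Mathlib

namespace CoinSorting

/-- An adaptive procedure with a two-pan balance on the coins labelled by `Fin n`. It either stops
and announces a set of coins as the heavier ones, or puts two disjoint sets of coins (of any sizes)
on the two pans and goes on according to the outcome of the weighing: left pan lighter, pans in
balance, or left pan heavier. Only the given `n` coins are available. -/
inductive Strategy (n : ℕ) : Type
  | announce (heavy : Finset (Fin n)) : Strategy n
  | weigh (left right : Finset (Fin n)) (disj : Disjoint left right)
      (ifLighter ifBalanced ifHeavier : Strategy n) : Strategy n

/-- The number of weighings made by a strategy in the worst case. -/
def Strategy.weighings {n : ℕ} : Strategy n → ℕ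
  | .announce _ => 0
  | .weigh _ _ _ sLt sEq sGt => max sLt.weighings (max sEq.weighings sGt.weighings) + 1

/-- The set announced by a strategy when the weights of the coins are given by `w`. -/
noncomputable def Strategy.run {n : ℕ} (w : Fin n → ℝ) : Strategy n → Finset (Fin n)
  | .announce heavy => heavy
  | .weigh left right _ sLt sEq sGt =>
      if ∑ i ∈ left, w i < ∑ i ∈ right, w i then sLt.run w
      else if ∑ i ∈ right, w i < ∑ i ∈ left, w i then sGt.run w
      else sEq.run w

/-- Each coin has one of two distinct positive weights. It is not required that both occur. -/
def TwoWeights {n : ℕ} (w : Fin n → ℝ) : Prop :=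
  ∃ a b : ℝ, 0 < a ∧ a < b ∧ ∀ i, w i = a ∨ w i = b

/-- The set `H` sorts the coins by weight: coin `i` is lighter than coin `j` exactly when `j` is in
`H` and `i` is not. If both weights occur, then `H` has to be the set of the heavier coins; if all
coins have the same weight, then `H` has to be empty or the set of all coins, and both of these
announce that all coins have the same weight. -/
def SortedBy {n : ℕ} (H : Finset (Fin n)) (w : Fin n → ℝ) : Prop :=
  ∀ i j, w i < w j ↔ i ∉ H ∧ j ∈ H

/-- A strategy sorts if it is right for all weights; the two weights are not known beforehand. -/
def Strategy.Sorts {n : ℕ} (s : Strategy n) : Prop :=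
  ∀ w : Fin n → ℝ, TwoWeights w → SortedBy (s.run w) w

/-- The numbers of weighings within which `n` coins of two possible weights can be sorted. -/
def sufficient (n : ℕ) : Set ℕ :=
  {k | ∃ s : Strategy n, s.Sorts ∧ s.weighings ≤ k}

/-- The least number of weighings needed to sort `n` coins of two possible distinct weights. -/
noncomputable def gBar (n : ℕ) : ℕ := sInf (sufficient n)

end CoinSorting

/-! Lower bound: a strategy with at most `k` weighings can announce at most `3 ^ k` sets, and one
announcement cannot be right for two different heavy sets other than the set of all coins
(`SortedBy.eq_of_ne_univ`). So `2 ^ n - 1` heavy sets need distinct announcements.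

Upper bound: every weighing used has equally many coins on both pans, so its outcome compares the
numbers of heavy coins and the unknown weights drop out (`sum_weights_lt_iff`). The coins are sorted
block by block. A block that contains both weights supplies a light reference coin for the coins
that follow (`SortableWithLight`). A constant block supplies only equal coins, which is weaker; in
return its constancy is recognised one weighing early. The saved weighing pays for sorting the next
coins against equal ones (`SortableWithEqual`), and the saving is passed on if these are equal too
(`SortableBlock.add`). In this way eleven more coins cost seven more weighings, and induction starts
from the sizes 4 to 14.

The base blocks of 4, 6, 9, 11 and 14 coins, with 3, 4, 6, 7 and 9 weighings, come from explicit
lists. A family of heavy sets is stored as a truth table, so a few bitwise operations split it by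
the outcome of a weighing and the kernel can check the whole tree. Soundness rests on `Scheme.check`
alone (`Scheme.solvable`); `expand` merely proposes a tree and needs no proof. -/

namespace CoinSorting

/-! ### Weighing schemes for labelled coins, evaluated on truth tables

A set of coins among `0, …, m - 1` is coded by the number `s < 2 ^ m` whose binary digits tell which
coins belong to it, and a family of such sets by the number `S` whose digit `s` tells whether the set
with code `s` belongs to the family. The operations on `ℕ` are written without notation, so that the
kernel evaluates them at once. -/

/-- The code of the family of those subsets of `{0, …, m - 1}` which contain `i`. -/
def column (i m : ℕ) : ℕ :=
  Nat.mul (Nat.div (Nat.sub (Nat.pow 2 (Nat.pow 2 m)) 1) (Nat.add (Nat.pow 2 (Nat.pow 2 i)) 1))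
    (Nat.pow 2 (Nat.pow 2 i))

/-- A weighing scheme. Coins are put on the pans in pairs, one on the left and one on the right. -/
inductive Scheme : Type
  | done : Scheme
  | weigh (pairs : List (ℕ × ℕ)) (ifLighter ifBalanced ifHeavier : Scheme) : Scheme

/-- Entry `d` of the list `T` is the family of sets for which the excess of heavy coins on the left pan
is `d` up to a shift. After another pair of coins has been put on the pans, for which `A` and `B` are
the families of sets which contain its left and right coin, the shift is larger by one. The families
`x` and `y` are added to the first two entries of the new list. -/
def spread (A B : ℕ) : ℕ → ℕ → List ℕ → List ℕ
  | x, y, [] => [x, y]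
  | x, y, t :: T =>
    let u := Nat.land t A
    let v := Nat.land t B
    let w := Nat.land u B
    Nat.lor x (Nat.xor v w) :: spread A B (Nat.lor y (Nat.xor (Nat.xor t u) v)) (Nat.xor u w) T

/-- The families of sets by their excess of heavy coins on the left pan. -/
def tally (m : ℕ) : List (ℕ × ℕ) → List ℕ → List ℕ
  | [], T => T
  | p :: P, T => tally m P (spread (column p.1 m) (column p.2 m) 0 0 T)

/-- The union of a list of families. -/
def unionAll : List ℕ → ℕ
  | [] => 0
  | t :: T => Nat.lor t (unionAll T)

/-- The union of the first families in a list, as many as there are pairs, and of `x`; the next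
family; and the union of the remaining ones. -/
def splitTally : List (ℕ × ℕ) → List ℕ → ℕ → ℕ × ℕ × ℕ
  | _ :: P, t :: T, x => splitTally P T (Nat.lor x t)
  | [], t :: T, x => (x, t, unionAll T)
  | _, [], x => (x, 0, 0)

/-- The sets in the family `S` for which the left pan is lighter, balances, or is heavier. -/
def outcomes (m : ℕ) (P : List (ℕ × ℕ)) (S : ℕ) : ℕ × ℕ × ℕ :=
  splitTally P (tally m P [S]) 0

/-- The family which consists of the empty set and of the set of all coins. -/
def constantSets (m : ℕ) : ℕ := Nat.lor 1 (Nat.pow 2 (Nat.sub (Nat.pow 2 m) 1))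

/-- Nothing is left to be found out about the family `S` when `k` weighings remain. It has to be
known `c` weighings ahead of time that all coins have the same weight. -/
def settled (m c k S : ℕ) : Bool :=
  Nat.beq S 0 ||
    ((Nat.beq (Nat.land S (constantSets m)) 0 && Nat.beq (Nat.land S (Nat.sub S 1)) 0) ||
      (Nat.ble c k && Nat.beq (Nat.lor S (constantSets m)) (constantSets m)))

/-- The entries of the list are distinct. -/
def allDistinct : List ℕ → Bool
  | [] => true
  | a :: L => L.all (fun b => !Nat.beq a b) && allDistinct L

/-- The scheme settles every set in the family `S` with at most `k` weighings. -/
def Scheme.check (m c : ℕ) : Scheme → ℕ → ℕ → Bool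
  | .done, k, S => settled m c k S
  | .weigh _ _ _ _, 0, _ => false
  | .weigh P l e g, k + 1, S =>
    allDistinct (P.map Prod.fst ++ P.map Prod.snd) &&
    P.all (fun p => Nat.blt p.1 m && Nat.blt p.2 m) &&
    match outcomes m P S with
    | (x, y, z) => l.check m c k x && e.check m c k y && g.check m c k z

/-- The scheme with the pans exchanged in each weighing. -/
def Scheme.mirror : Scheme → Scheme
  | .done => .done
  | .weigh P l e g => .weigh (P.map Prod.swap) l.mirror e.mirror g.mirror

/-- Pairs of coins from the hexadecimal digits of a number, where the digit `i + 1` means coin `i`. -/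
def pairsOfDigits : ℕ → ℕ → List (ℕ × ℕ)
  | 0, _ => []
  | f + 1, w =>
    match Nat.mod (Nat.div w 16) 16, Nat.mod w 16 with
    | a + 1, b + 1 => (a, b) :: pairsOfDigits f (Nat.div w 256)
    | _, _ => []

/-- The position of the highest digit of a number with at most `2 ^ j` binary digits. -/
def topDigit : ℕ → ℕ → ℕ
  | 0, _ => 0
  | j + 1, S =>
    bif Nat.beq (Nat.shiftRight S (Nat.pow 2 j)) 0 then topDigit j S
    else Nat.add (Nat.pow 2 j) (topDigit j (Nat.shiftRight S (Nat.pow 2 j)))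

/-- A pair of coins from the sets `u` and `v`, either both outside of `r` or both in `r`. -/
def pairFrom (u v r : ℕ) : Option (ℕ × ℕ) :=
  let u₁ := Nat.land u r
  let v₁ := Nat.land v r
  bif Nat.beq u u₁ || Nat.beq v v₁ then
    bif Nat.beq u₁ 0 || Nat.beq v₁ 0 then none else some (topDigit 4 u₁, topDigit 4 v₁)
  else some (topDigit 4 (Nat.xor u u₁), topDigit 4 (Nat.xor v v₁))

/-- A pair of coins with different outcomes for the sets with the codes `p`, `q`, `r`, where the last
one is to give balance. -/
def separateInOrder (p q r : ℕ) : Option (ℕ × ℕ) :=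
  pairFrom (Nat.xor p (Nat.land p q)) (Nat.xor q (Nat.land p q)) r

/-- A pair of coins with different outcomes for the two or three sets in the family `S`. -/
def separatingPair (m S : ℕ) : ℕ × ℕ :=
  let p := topDigit m S
  let S := Nat.xor S (Nat.pow 2 p)
  let q := topDigit m S
  let S := Nat.xor S (Nat.pow 2 q)
  bif Nat.beq S 0 then
    let u := Nat.xor p q
    (separateInOrder p q p).getD (topDigit 4 u, topDigit 4 (Nat.xor (Nat.sub (Nat.pow 2 m) 1) u))
  else
    let r := topDigit m S
    ((separateInOrder p q r <|> separateInOrder q r p) <|> separateInOrder p r q).getD (0, 0)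

/-- Expands a list of weighings in depth-first order into a scheme for the family `S`. The last
weighing on each path is left out of the list. As long as all weighings have balanced, the branch for
a heavier left pan mirrors the one for a lighter left pan and is left out, too. -/
def expand (m c : ℕ) : ℕ → ℕ → List ℕ → Scheme × List ℕ
  | 0, _, L => (.done, L)
  | k + 1, S, L =>
    bif settled m c (k + 1) S then (.done, L) else
      bif Nat.beq k 0 then (.weigh [separatingPair m S] .done .done .done, L) else
        match L with
        | [] => (.done, [])
        | w :: L =>
          match outcomes m (pairsOfDigits m w) S with
          | (x, y, z) =>
            match expand m c k x L with
            | (l, L) =>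
              match expand m c k y L with
              | (e, L) =>
                -- Constant sets always balance, so both survive exactly while every outcome was
                -- balance. The family is then closed under complements, and complementing exchanges
                -- the two unbalanced outcomes.
                bif Nat.beq (Nat.land S (constantSets m)) (constantSets m) then
                  (.weigh (pairsOfDigits m w) l e l.mirror, L)
                else
                  match expand m c k z L with
                  | (g, L) => (.weigh (pairsOfDigits m w) l e g, L)

/-- The family of all sets of coins among `0, …, m - 1`. -/
def allSets (m : ℕ) : ℕ := Nat.sub (Nat.pow 2 (Nat.pow 2 m)) 1

/-- The check of the scheme which is given by a list of weighings for all sets of `m` coins. -/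
def checkList (m c k : ℕ) (L : List ℕ) : Bool :=
  (expand m c k (allSets m) L).1.check m c k (allSets m)

/-! ### Explicit weighing schemes for small blocks -/

theorem checkList_four : checkList 4 1 3 [
  0x1324, 0x1234, 0x34] = true := by
  decide +kernel

theorem checkList_six : checkList 6 1 4 [
  0x142536, 0x1245, 0x3256, 0x2345, 0x3146, 0x1546, 0x56, 0x56] = true := by
  decide +kernel

theorem checkList_nine : checkList 9 1 6 [
  0x142536, 0x164758, 0x237498, 0x6397, 0x537486, 0x37, 0x34, 0x54, 0x4697, 0x6798, 0x5678, 0x2579,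
  0x6587, 0x2859, 0x95, 0x234679, 0x1469, 0x3456, 0x45, 0x38, 0x87, 0x13, 0x21, 0x4295, 0x86,
  0x2137, 0x98, 0x3589, 0x254769, 0x8197, 0x3179, 0x17, 0x3498, 0x2156, 0x3469, 0x61, 0x82, 0x2154,
  0x1398, 0x6182, 0x2689, 0x1546, 0x21374859, 0x125378, 0x79, 0x67, 0x89, 0x56, 0x78, 0x21, 0x78,
  0x23, 0x7186, 0x78, 0x7186, 0x56, 0x2879, 0x1689, 0x89, 0x6187, 0x7185, 0x78, 0x79] = true := by
  decide +kernel

theorem checkList_eleven : checkList 11 1 7 [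
  0x142536, 0x45798a, 0x12739a, 0x42568b, 0x7394a5, 0x94ba, 0x32ab, 0x548b, 0x52ba, 0x427398,
  0x5379, 0x73b9, 0x2349, 0x34768b, 0x286b, 0x4278, 0x648b, 0x264b, 0x34b6, 0x32b5, 0x57ba, 0xa4b6,
  0x23, 0x568b, 0x569b, 0x48ab, 0x175b, 0x2356, 0x47, 0x16879b, 0x84ba, 0x7184a9, 0x1a5b, 0x2183b5,
  0x95ba, 0x5486, 0x286b, 0x2194, 0x687b, 0x2156ba, 0x215a, 0x14a6, 0x5479ba, 0x1568, 0x1296,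
  0x5273a6, 0xa9, 0x85a9, 0x239a, 0xa3b4, 0x17, 0x92b4, 0x7a9b, 0x2153b8, 0x1327, 0x2137, 0x9a,
  0x4152869a, 0x6184, 0x37, 0x1648, 0x132648, 0x386b, 0x36, 0x386b, 0x415286a9, 0x6184, 0x37,
  0x1648, 0x7486, 0x1326b7, 0x718293, 0x12, 0x4687, 0x5698, 0x128396ba, 0x1253a7b9, 0x129a, 0x129a,
  0x2346ab, 0x658b, 0x13469b, 0x127398, 0x4256ab, 0x738495, 0x75b8, 0x328b, 0x45ab, 0x42b8,
  0x52739a, 0x4397, 0x93b7, 0x2357, 0x3596ab, 0x2a6b, 0x529a, 0x65ab, 0x265b, 0x35b6, 0x32b4,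
  0x48b9, 0x85b6, 0x23, 0x46ab, 0x467b, 0x5a8b, 0x194b, 0x2346, 0x59, 0x1679ab, 0xa5b8, 0x8195a7,
  0x184b, 0x21a3b4, 0x74b8, 0x45a6, 0x2a6b, 0x2175, 0x6a9b, 0x2146b8, 0x2148, 0x1586, 0x14798a,
  0x7194, 0x1253, 0x2358, 0x283a6b, 0x32b8, 0xa3b5, 0x23, 0x387a9b, 0x587a9b, 0x287a9b, 0x23,
  0x387a9b, 0x187a9b, 0x287a9b, 0x457a, 0x41b9, 0x1325b6, 0x46, 0x46, 0x87, 0x71b9, 0xa2b3, 0xa2b3,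
  0x23, 0x93b7, 0x42b6, 0x92b7, 0x2546, 0x56, 0x176a8b, 0x172a8b, 0x175a8b, 0x56, 0x176a8b,
  0x178a9b, 0x175a8b, 0x2358, 0x283a6b, 0x2a6b, 0xa3b5, 0x5496, 0x23, 0x78, 0x48ba, 0x47ba, 0x47ba,
  0x16, 0x2798ba, 0x12b5, 0x78, 0x78, 0x48ba, 0x47ba, 0x47ba, 0x92b4, 0x52a3, 0x78, 0xa4, 0x72,
  0x95, 0x16, 0x78] = true := by
  decide +kernel

theorem checkList_fourteen : checkList 14 1 9 [
  0x142536, 0x45798a, 0x127698, 0x8b9c, 0x325a6b, 0x196c, 0x45cb, 0xd6e9, 0x6d9e, 0xd6e9, 0x3748,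
  0x387dce, 0x2d5e, 0xd6ec, 0x74dc, 0x314c5e, 0x356dbe, 0x62e5, 0x12b9, 0x4d9e, 0xa2de, 0xda,
  0x43da, 0xbc, 0xd1e4, 0xd3e4, 0xd3e4, 0x8dce, 0x74bcde, 0x84, 0xc1d8, 0x94ca, 0x34bd, 0x437dce,
  0xc4eb, 0x147cbe, 0xbade, 0x83adbe, 0x3d8e, 0x83adbe, 0xd3eb, 0xd4e9, 0x2bcd, 0x2dce, 0x2d4e,
  0x49db, 0x8ade, 0x36a9, 0x527d, 0xd5ea, 0x56cb, 0x21be, 0x436a, 0x12c6, 0x236ced, 0x91c3, 0x436e,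
  0x42ea, 0x42a9, 0xde, 0x18ea, 0xbc, 0x18da, 0x528d, 0x34db, 0x26e8, 0xb5, 0x84, 0x64de, 0x3569,
  0x13b6, 0x62bc, 0x94de, 0x459a, 0x45ac, 0x54ad, 0x148dbe, 0xde, 0x38ab, 0x318a, 0x62a5, 0x23d4,
  0xa3d4, 0x59, 0x7294, 0x1356, 0x385abd, 0xc3d5e8, 0x8aed, 0x78eb, 0x486abd, 0x748dae, 0x8aed,
  0x78eb, 0xbc, 0xd1e6, 0x1d6e, 0xd1e6, 0x4258, 0xbcde, 0x2a7dce, 0xadce, 0x2a7dbe, 0x13a6, 0xd2e9,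
  0xd2e9, 0x1d6e, 0x3cbd, 0x437dce, 0xc3ed, 0x437dbe, 0xbc, 0x3a5d, 0x257dae, 0xa5ed, 0x135ade,
  0x3a5d, 0x257dae, 0xa5ed, 0x135ade, 0x3a5d, 0x257dae, 0xa5ed, 0x135ade, 0x96bdce, 0x1467ba,
  0x3657, 0x748d, 0x429dce, 0xc2e9, 0x79ce, 0x38b9, 0xc4de, 0xc2d4e7, 0x7dce, 0x8cde, 0x6394ec,
  0x93d4, 0x63d4, 0xacbd, 0x1a9c, 0x31a5, 0x195c, 0xe6, 0x315d, 0xd1e4, 0x9e, 0xa9, 0x45ed, 0x739e,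
  0x3b5e, 0x31e4, 0x69ad, 0x195bde, 0xc3e5, 0x39eb, 0x215e, 0x95ed, 0x1c8e, 0x41a8, 0x91a5,
  0x3bacde, 0x7aed, 0x1bce, 0xa3b4cd, 0x4cbd, 0x3b6d, 0x89de, 0x657a, 0x8bae, 0x1a5c, 0x346a,
  0xa2e5, 0x71c6, 0x759b, 0x5ade, 0xb5e7, 0x7e, 0x548a, 0x849b, 0x36a9, 0x517a, 0x71, 0xb4, 0x54ba,
  0x1245, 0xac, 0x32a7, 0x657e, 0x3aed, 0xa1b8, 0x35679a, 0x82b9, 0x427b, 0x64ae, 0x26ea, 0x32c7,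
  0x64a5, 0x93e5, 0x345a, 0x34ea, 0x384e, 0x46ea, 0x46, 0xa3d6, 0x8394d6, 0x54a9bc, 0x94ba, 0x23a5,
  0x53, 0x135b, 0x7cbe, 0x39ae, 0x23ca, 0x12b3, 0x46, 0x3c, 0x21, 0x43ec, 0x265a, 0xb5e8, 0xbc,
  0x6ade, 0x2a6cbe, 0x469a, 0xb2c7ea, 0xd4ea, 0x4bec, 0xacbe, 0x72ce, 0xb4c5, 0xab, 0x86eb, 0x78da,
  0x1c7d, 0x48, 0x2c, 0x6a9d, 0x34dc, 0xc8, 0xb6, 0x4bac, 0x7aed, 0x74ad, 0x4ade, 0x1b6c, 0x2147,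
  0x869a, 0x56db, 0x13256e, 0x36c9ed, 0x2b5dae, 0x13bc, 0xd3e6, 0x2a6dbe, 0xd1e4, 0xbc, 0x8dae,
  0xd8ea, 0x8dae, 0x175b, 0x63cd, 0x2c3d7e, 0x637ced, 0x263dce, 0xbcde, 0xb3ce, 0xab, 0x2abced,
  0x289a, 0x8d9e, 0xd1e4, 0x1d4e, 0xbc, 0x3a5d, 0x257dae, 0xa5ed, 0x538ade, 0x3a5d, 0x257dae,
  0xa5ed, 0x538ade, 0x3a5d, 0x257dae, 0xa5ed, 0x538ade, 0x74de, 0x41db, 0x23a6, 0x64cade, 0x47de,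
  0x2879ae, 0x5ace, 0x86, 0x37c9, 0x69ca, 0x3d5e, 0x81dc, 0x37, 0x536a9e, 0x164b, 0x31, 0x178e,
  0x4c, 0xc4, 0xe1, 0x15da, 0x57ec, 0x8aec, 0x4175, 0x89ab, 0x3dae, 0xd7, 0x97bc, 0x3a9e, 0x5d9e,
  0x56da, 0x236a9d, 0x4ade, 0x81eb, 0x81db, 0x14da, 0xd3e6, 0x256a7d, 0xa5ec, 0x75ba, 0x3a4d9e,
  0x5174b9, 0x45d6, 0xcade, 0x24679c, 0x59, 0x1ade, 0x81e5, 0x287e, 0x8e, 0x8b9c, 0x1b2dce, 0xadbe,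
  0xa9de, 0xde, 0x74ea, 0x56, 0x4172b6, 0x71, 0x475a, 0x2178, 0x31, 0x43b6, 0x74da, 0x56, 0x4172b6,
  0x71, 0x517396, 0xbc, 0x3cde, 0x34de, 0x3bde, 0xbc, 0x478a, 0x478a, 0x478a, 0x6284, 0x12da,
  0x31a6, 0x13de, 0x45bdce, 0x78bcde, 0x569cad, 0x1265dc, 0x48cd, 0x82be, 0x32, 0x64, 0x34cd, 0x18,
  0x9aed, 0xb7, 0x5a9c, 0x47, 0x8ced, 0x95, 0x71c2, 0x1248, 0x34ed, 0x215e, 0x183d, 0x46e8, 0x53be,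
  0x34d9, 0x96, 0x9a, 0x36, 0x34cd, 0x36, 0x17498e, 0x46, 0x2356, 0x23a9, 0x23, 0x284a, 0x698a,
  0x36, 0x4869, 0x21a6, 0x16d9, 0x61, 0x32, 0x489ade, 0x87ea, 0x146e, 0x1246, 0xe5, 0x132c, 0x68bd,
  0x1267, 0x1258cb, 0x132b, 0x1abd, 0x62c3, 0x1243c6, 0x2156, 0xc7d8, 0x1a8e, 0x62b3, 0x12a3b6,
  0x2186, 0x86ba, 0x12, 0x126a, 0x168c, 0x126c, 0x64ca, 0xa6ec, 0x64ca, 0x78, 0x184b6e, 0x12b6,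
  0x64, 0x2364, 0x12e5, 0xe6, 0x23, 0x56, 0x146c7d, 0x12c6, 0xc4, 0x2364, 0x569bae, 0x1265eb,
  0x47be, 0x72cd, 0x32, 0x64, 0x34be, 0x17, 0x9ade, 0xc8, 0x5a9b, 0x48, 0x7bde, 0x95, 0x81b2,
  0x1247, 0x34de, 0x215d, 0x173e, 0x46d7, 0x53cd, 0x34e9, 0x96, 0x9a, 0x36, 0x34be, 0x36, 0x18497d,
  0x46, 0x2356, 0x23a9, 0x23, 0x274a, 0x697a, 0x36, 0x4769, 0x21a6, 0x16e9, 0x61, 0x32, 0x145d6e,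
  0x1256, 0x3264, 0x9ade, 0x9b, 0x2abd, 0xab, 0x9ade, 0x7d, 0x4abd, 0x7e, 0x3d6e, 0x9a, 0x9abc,
  0x9ade, 0x95de, 0x78, 0xbc, 0xad, 0xbc, 0xa5, 0x72, 0xa4bc, 0xbc, 0x78, 0xbc, 0xbc, 0xbc, 0x9a,
  0xde, 0x37bc, 0x13, 0x37bc, 0xde, 0x738b, 0x13, 0x738b, 0xde, 0x37bc, 0x13, 0x37bc, 0x459a,
  0x2378bc, 0x85de, 0xb3ec, 0x3e, 0xb3c5, 0xbc, 0x74d5, 0x84, 0x84d5, 0x75de, 0xc2eb, 0x2e, 0xb2c5,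
  0xb7d8, 0x264c, 0x4e, 0xec, 0x2b3e, 0xbe, 0x24e5, 0x23, 0x24b5, 0xc5de, 0x2365, 0x236b, 0x24d5,
  0x12d7, 0x65e7, 0x327d, 0xa2b3ec, 0x37, 0xd8, 0x3485, 0xb6, 0x74b5, 0x61d9, 0xd8, 0x6b8e, 0x84b5,
  0x2164, 0x78, 0xbc, 0x3a9d, 0x396a, 0x3a9d, 0xbc, 0x39da, 0x396a, 0x39da, 0xbc, 0x3a9d, 0x396a,
  0x3a9d, 0x72b8, 0x9a, 0xde, 0x82, 0xde, 0xbc, 0x91c6, 0x91, 0x82, 0x9a, 0x41, 0xcb, 0x41, 0x3265,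
  0x78bc, 0x9a, 0x279c, 0x9a, 0x78bc, 0xb7, 0x579c, 0xc8, 0x78bc, 0x9a, 0x6398, 0x9a, 0x9abcde,
  0x467b8e, 0x1264be, 0x5aeb, 0xa2dc, 0x32, 0x65, 0x35eb, 0x1a, 0x78cb, 0xd9, 0x487e, 0x59, 0xabce,
  0x74, 0x91e2, 0x125a, 0x35cb, 0x214c, 0x1a3b, 0x56ca, 0x43dc, 0x35b7, 0x76, 0x78, 0x36, 0x35eb,
  0x36, 0x1759ac, 0x56, 0x2346, 0x2387, 0x23, 0x285a, 0x67a8, 0x36, 0x576a, 0x2186, 0x16b7, 0x61,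
  0x32, 0x587abc, 0xa8c9, 0x156c, 0x1256, 0xc4, 0x132e, 0x6adb, 0x1269, 0x124aed, 0x132d, 0x18db,
  0x62e3, 0x1253e6, 0x2146, 0xb9ea, 0x18ac, 0x62d3, 0x1283d6, 0x21a6, 0xa6d8, 0x12, 0x1268, 0x16ae,
  0x126e, 0x65e8, 0x86ce, 0x65e8, 0x9a, 0x1a5c6d, 0x12d6, 0x65, 0x2365, 0x12c4, 0xc6, 0x23, 0x46,
  0x156b9e, 0x12e6, 0xe5, 0x2365, 0x467c8d, 0x1264cd, 0x59dc, 0x92eb, 0x32, 0x65, 0x35dc, 0x19,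
  0x78bc, 0xea, 0x487d, 0x5a, 0x9cbd, 0x74, 0xa1d2, 0x1259, 0x35bc, 0x214b, 0x193c, 0x56b9, 0x43eb,
  0x35c7, 0x76, 0x78, 0x36, 0x35dc, 0x36, 0x175a9b, 0x56, 0x2346, 0x2387, 0x23, 0x2859, 0x6798,
  0x36, 0x5769, 0x2186, 0x16c7, 0x61, 0x32, 0x12769a, 0x7bac, 0x32486b, 0x176c, 0x54cb, 0xd6e7,
  0x6d7e, 0xd6e7, 0x395a, 0x3a9dce, 0x2d4e, 0xd6ec, 0x95dc, 0x314c5e, 0x346dbe, 0x62e4, 0x12b7,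
  0x5d7e, 0x82de, 0xd8, 0x53d8, 0xbc, 0xd1e5, 0xd3e5, 0xd3e5, 0xadce, 0x95bcde, 0xa5, 0xc1da,
  0x75c8, 0x35bd, 0x539dce, 0xc5eb, 0x159cbe, 0xb8de, 0x83adbe, 0x3dae, 0x83adbe, 0xd3eb, 0xd5e7,
  0x2bcd, 0x2dce, 0x2d5e, 0x57db, 0xa8de, 0x3687, 0x429d, 0xd4e8, 0x46cb, 0x21be, 0x5368, 0x12c6,
  0x236ced, 0x71c3, 0x536e, 0x52e8, 0x5287, 0xde, 0x18ea, 0xbc, 0x18da, 0x42ad, 0x35db, 0x26ea,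
  0xb4, 0xa5, 0x65de, 0x3467, 0x13b6, 0x62bc, 0x75de, 0x5478, 0x548c, 0x458d, 0x15adbe, 0xde,
  0x3a8b, 0x31a8, 0x6284, 0x23d5, 0x83d5, 0x47, 0x7295, 0x1346, 0x384abd, 0xc3d4ea, 0xa8ed, 0x9aeb,
  0x586abd, 0x859dae, 0xa8ed, 0x9aeb, 0xbc, 0xd1e6, 0x1d6e, 0xd1e6, 0x425a, 0xbcde, 0x289dce,
  0x8dce, 0x289dbe, 0x1386, 0xd2e7, 0xd2e7, 0x1d6e, 0x3cbd, 0x539dce, 0xc3ed, 0x539dbe, 0xbc,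
  0x384d, 0x248d9e, 0x84ed, 0x1348de, 0x384d, 0x248d9e, 0x84ed, 0x1348de, 0x384d, 0x248d9e, 0x84ed,
  0x1348de, 0x76bdce, 0x1568b9, 0x3649, 0x95ad, 0x527dce, 0xc2e7, 0x97ce, 0x37ba, 0xc5de, 0xc2d5e9,
  0x9dce, 0xacde, 0x6375ec, 0x73d5, 0x63d5, 0x8cbd, 0x187c, 0x3184, 0x174c, 0xe6, 0x314d, 0xd1e5,
  0x7e, 0x87, 0x54ed, 0x739e, 0x3b4e, 0x31e5, 0x678d, 0x174bde, 0xc3e4, 0x37eb, 0x214e, 0x74ed,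
  0x1cae, 0x518a, 0x7184, 0x3b8cde, 0x98ed, 0x1bce, 0x83b5cd, 0x5cbd, 0x3b6d, 0xa7de, 0x6498,
  0x8bae, 0x184c, 0x3568, 0x82e4, 0x91c6, 0x749b, 0x48de, 0xb4e9, 0x9e, 0x45a8, 0x75ab, 0x3687,
  0x4198, 0x91, 0xb5, 0x45b8, 0x1254, 0x8c, 0x3289, 0x649e, 0x38ed, 0x81ba, 0x346879, 0xa2b7,
  0x529b, 0x658e, 0x26e8, 0x32c9, 0x6485, 0x73e4, 0x3548, 0x35e8, 0x3a5e, 0x56e8, 0x56, 0x83d6,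
  0x73a5d6, 0x4587bc, 0x75b8, 0x2384, 0x43, 0x134b, 0x9cbe, 0x378e, 0x23c8, 0x12b3, 0x56, 0x3c,
  0x21, 0x53ec, 0x2648, 0xb4ea, 0xbc, 0x68de, 0x286cbe, 0x5678, 0xb2c8e9, 0xd5e8, 0x5bec, 0x8cbe,
  0x92ce, 0xb4c5, 0x8b, 0xa6eb, 0x98da, 0x1c9d, 0x5a, 0x2c, 0x687d, 0x35dc, 0xca, 0xb6, 0x5b8c,
  0x98ed, 0x859d, 0x58de, 0x1b6c, 0x2159, 0x76a8, 0x46db, 0x13246e, 0x36c7ed, 0x2b4d8e, 0x13bc,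
  0xd3e6, 0x286dbe, 0xd1e5, 0xbc, 0x8dae, 0xd8ea, 0x8dae, 0x194b, 0x63cd, 0x2c3d9e, 0x639ced,
  0x263dce, 0xbcde, 0xb3ce, 0x8b, 0x28bced, 0x287a, 0x7dae, 0xd1e5, 0x1d5e, 0xbc, 0x384d, 0x248d9e,
  0x84ed, 0x43a8de, 0x384d, 0x248d9e, 0x84ed, 0x43a8de, 0x384d, 0x248d9e, 0x84ed, 0x43a8de, 0x95de,
  0x51db, 0x2386, 0x65c8de, 0x59de, 0x278a9e, 0x48ce, 0xa6, 0x37c9, 0x67c8, 0x3d4e, 0xa1dc, 0x39,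
  0x43687e, 0x165b, 0x31, 0x19ae, 0x5c, 0xc5, 0xe1, 0x14d8, 0x49ec, 0xa8ec, 0x5194, 0x87ab, 0x3d8e,
  0xd9, 0x79bc, 0x387e, 0x4d7e, 0x46d8, 0x23687d, 0x58de, 0xa1eb, 0xa1db, 0x15d8, 0xd3e6, 0x24689d,
  0x84ec, 0x94b8, 0x385d7e, 0x4195b7, 0x54d6, 0xc8de, 0x25697c, 0x47, 0x18de, 0xa1e4, 0x2a9e, 0xae,
  0x7bac, 0x1b2dce, 0x8dbe, 0x87de, 0xde, 0x95e8, 0x46, 0x5192b6, 0x91, 0x4859, 0x219a, 0x31,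
  0x53b6, 0x95d8, 0x46, 0x5192b6, 0x91, 0x417396, 0xbc, 0x3cde, 0x35de, 0x3bde, 0xbc, 0x58a9,
  0x58a9, 0x58a9, 0x62a5, 0x12d8, 0x3186, 0x13de, 0x48597a, 0x4589, 0x15a8, 0x23, 0x71bdce, 0x1d3e,
  0xba, 0xbcde, 0xde, 0xabdc, 0xbc, 0xbc, 0xed, 0x3b7c, 0xde, 0x2a3d4e, 0xbc, 0x6c7dbe, 0x1c8d,
  0x6abe, 0xa6ce, 0xb1ec, 0x68ab, 0x1b, 0xcd, 0xcd, 0x87ca, 0x4b7d, 0x4b7dce, 0x8bdc, 0x71bdce,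
  0x1d2e, 0xba, 0xbcde, 0xde, 0xabdc, 0xbc, 0xbc, 0xed, 0x2b7c, 0xde, 0x2a3d4e, 0xbc, 0x23,
  0x56bdce, 0x35bd, 0x17ce, 0x71de, 0x6bce, 0x31d5, 0xbc, 0xe7, 0x6d, 0x36db, 0x17ec, 0x71bc,
  0x5ced, 0x2c5dbe, 0x95bc, 0xde, 0x719dce, 0x9dce, 0x51b8, 0xcd, 0x719b, 0xb2, 0x51cb, 0x71b8,
  0x72bd, 0x2bdc, 0x56bdce, 0x25bd, 0x17ce, 0x71de, 0x6bce, 0x21d5, 0xbc, 0xe7, 0x6d, 0x26db,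
  0x17ec, 0x71bc, 0x5ced, 0x7196, 0x2cadbe, 0x1abc, 0xde, 0x1a3d6e, 0x1dce, 0x5dce, 0xde, 0x5b,
  0xb5, 0x12c5, 0x2b4d, 0xcbde, 0xb3da, 0x2c6dbe, 0x1dce, 0x1c, 0x5cad, 0xde, 0x61ca, 0xd5, 0xde,
  0x2b, 0x12ab, 0xcd, 0x23cd, 0xa7cb, 0x2c7dbe, 0xa7bc, 0xde, 0x379dae, 0xadce, 0xa6b7, 0xcd, 0xcd,
  0xcd, 0xa2c6, 0x2b4d, 0x3bde, 0x37bd, 0x6578, 0x13298a, 0x39bdce, 0xa3bd, 0x31c4, 0x14de, 0x9bce,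
  0xa4b9, 0xde, 0xde, 0xde, 0xa9db, 0x91e4, 0xbcde, 0x3ced, 0x12bdce, 0x869d, 0x1bde, 0x1b4c7e,
  0xb4de, 0x83d6, 0x12, 0xb1, 0xde, 0x869b, 0x2cbd, 0x2c4d7e, 0xb4dc, 0x12bdce, 0x51bd, 0x12c4,
  0x61de, 0x2bce, 0x12de, 0xb1, 0x64, 0xbc, 0x52db, 0x21e4, 0x62bc, 0x1ced, 0xa8, 0x1c6dbe, 0x7c8d,
  0x2e, 0xb7ec, 0xb7ec, 0xcbde, 0x2b, 0x1b, 0xcd, 0x216b, 0x1bcd, 0x13cd, 0xc3de, 0x1c6dbe, 0x7cad,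
  0x2e, 0x26ce, 0xb7ec, 0xcbde, 0x2b, 0xb1, 0xcd, 0x216b, 0x1bcd, 0x31cd, 0xc3de, 0x1c4dbe, 0xa4bc,
  0xde, 0xadce, 0xadce, 0xcbde, 0x2b, 0xcd, 0xcd, 0x214b, 0x51bdce, 0x13cd, 0xc3de, 0x12, 0xa9bdce,
  0x27ad, 0x5b7e, 0x5bacde, 0xa9de, 0xa9de, 0x7e, 0x7e, 0xbc, 0x29db, 0xe7, 0x79bc, 0xaced,
  0x93bdce, 0x3a9d, 0x4bde, 0x5b7c8e, 0xabed, 0x93da, 0xbc, 0xa7, 0xbc, 0x3a9b, 0x3cbd, 0x7cde,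
  0xabcd, 0xa9bdce, 0x17ad, 0x5b7e, 0x5bacde, 0xa9de, 0xa9de, 0x7e, 0x7e, 0xbc, 0x19db, 0xe7,
  0x79bc, 0xaced, 0x14a9, 0x23, 0x71bdce, 0x1d3e, 0xba, 0xbcde, 0xde, 0xabdc, 0xbc, 0xbc, 0xed,
  0x3b7c, 0xde, 0x2a3d5e, 0xbc, 0x6c7dbe, 0x1c9d, 0x6abe, 0xa6ce, 0xb1ec, 0x69ab, 0x1b, 0xcd, 0xcd,
  0x97ca, 0x5b7d, 0x5b7dce, 0x9bdc, 0x71bdce, 0x1d2e, 0xba, 0xbcde, 0xde, 0xabdc, 0xbc, 0xbc, 0xed,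
  0x2b7c, 0xde, 0x2a3d5e, 0xbc, 0x23, 0x46bdce, 0x34bd, 0x17ce, 0x71de, 0x6bce, 0x31d4, 0xbc, 0xe7,
  0x6d, 0x36db, 0x17ec, 0x71bc, 0x4ced, 0x2c4dbe, 0x84bc, 0xde, 0x718dce, 0x8dce, 0x41b9, 0xcd,
  0x718b, 0xb2, 0x41cb, 0x71b9, 0x72bd, 0x2bdc, 0x46bdce, 0x24bd, 0x17ce, 0x71de, 0x6bce, 0x21d4,
  0xbc, 0xe7, 0x6d, 0x26db, 0x17ec, 0x71bc, 0x4ced, 0x7186, 0x2cadbe, 0x1abc, 0xde, 0x1a3d6e,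
  0x1dce, 0x4dce, 0xde, 0x4b, 0xb4, 0x12c4, 0x2b5d, 0xcbde, 0xb3da, 0x2c6dbe, 0x1dce, 0x1c, 0x4cad,
  0xde, 0x61ca, 0xd4, 0xde, 0x2b, 0x12ab, 0xcd, 0x23cd, 0xa7cb, 0x2c7dbe, 0xa7bc, 0xde, 0x378dae,
  0xadce, 0xa6b7, 0xcd, 0xcd, 0xcd, 0xa2c6, 0x2b5d, 0x3bde, 0x37bd, 0x4687, 0x152b9cad, 0x1537e9,
  0x2395b7, 0x5a6c, 0xa5e9, 0x6b, 0xbd, 0x8a, 0x21, 0xb9, 0xec, 0xc2e5, 0x7c, 0x92, 0x6d9e, 0x23b5,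
  0x98cd, 0xbc, 0x57, 0xe5, 0x82cd, 0xea, 0xe3, 0xad, 0xa8, 0xcd, 0x2bcd, 0xaced, 0x357bec, 0xa3de,
  0xa9, 0xe3, 0xbc, 0xbc, 0xe3, 0x37, 0xe3, 0xbc, 0x73dc, 0xd7, 0x73db, 0x12, 0xb9ec, 0x23dc, 0x89,
  0xa6, 0x6c, 0xed, 0xa6, 0x37, 0xa6, 0x576b, 0xd6, 0xae, 0x63ba, 0x3679, 0xbced, 0xe9, 0xcd, 0x8a,
  0x369e, 0xbc, 0x3e, 0xbc, 0x6cbe, 0xec, 0xea, 0xb6, 0xb9ec, 0x13dc, 0x89, 0xa6, 0x6c, 0xed, 0xa6,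
  0x37, 0xa6, 0x576b, 0xd6, 0xae, 0x63ba, 0x469bae, 0x7195, 0x98ea, 0xa2b8, 0x63ca, 0x12b9, 0x72ae,
  0x28ce, 0xa1, 0xbe, 0x32ea, 0xba, 0x8b, 0xc3, 0x129a, 0x12ae, 0xb3, 0xc3, 0x71, 0x72b5, 0xc3,
  0x52, 0x14cb, 0x219e, 0xb3, 0xc3, 0x72, 0x12, 0x23e4, 0xbc, 0xcd, 0xcd, 0x549c, 0xbe, 0xa1d4,
  0xc3d5, 0x13e4, 0xbc, 0xcd, 0xcd, 0x61b7cd, 0x65de, 0xd1e5, 0x1758e9, 0x21, 0xae, 0x98, 0x91ed,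
  0xa7b8, 0x97b8, 0x9a, 0x97e8, 0x23, 0xbc, 0x9d, 0x91ea, 0x75bc, 0x81, 0x1d, 0x18, 0x57, 0x71be,
  0xb2, 0x69bc, 0x8e, 0x23, 0xd8, 0xbc, 0x9a, 0x23bc, 0xc8de, 0x23, 0xb8de, 0x29da, 0xb3, 0x57,
  0xb5d8, 0x23bc, 0xc8de, 0x23, 0xb8de, 0x23, 0xd7, 0x9aeb, 0x48, 0x9a, 0xec, 0x98ea, 0xb1, 0x5a,
  0x5e, 0x15eb, 0x9b, 0x51, 0xce, 0x1d, 0xd2e6, 0x98, 0x98, 0xbc, 0x79ea, 0xbc, 0x9a] = true := by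
  decide +kernel

/-- For two and three coins `c = 0` is enough: these sizes are never extended by further coins, so
no weighing has to be saved. -/
theorem checkList_two : checkList 2 0 2 [0x12] = true := by
  decide +kernel

theorem checkList_three : checkList 3 0 2 [0x12] = true := by
  decide +kernel

/-! ### Truth tables -/

theorem column_top (i : ℕ) : column i (i + 1) = (2 ^ 2 ^ i - 1) * 2 ^ 2 ^ i := by
  have h : (2 ^ 2 ^ (i + 1) - 1 : ℕ) = (2 ^ 2 ^ i - 1) * (2 ^ 2 ^ i + 1) := by
    rw [pow_succ, pow_mul, mul_comm, ← Nat.sq_sub_sq, one_pow]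
  change (2 ^ 2 ^ (i + 1) - 1) / (2 ^ 2 ^ i + 1) * 2 ^ 2 ^ i = _
  rw [h, Nat.mul_div_cancel _ (by positivity)]

theorem two_pow_two_pow_add_one_dvd {i m : ℕ} (h : i < m) : 2 ^ 2 ^ i + 1 ∣ 2 ^ 2 ^ m - 1 := by
  have hs (k : ℕ) : (2 ^ 2 ^ (k + 1) - 1 : ℕ) = (2 ^ 2 ^ k - 1) * (2 ^ 2 ^ k + 1) := by
    rw [pow_succ, pow_mul, mul_comm, ← Nat.sq_sub_sq, one_pow]
  induction m, h using Nat.le_induction with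
  | base => exact ⟨_, (hs i).trans (mul_comm _ _)⟩
  | succ m _ ih => exact (hs m).symm ▸ ih.mul_right _

/-- A new top coin `m` does not affect digit `i` of the code, so the truth table is repeated in its
lower and upper half. -/
theorem column_succ {i m : ℕ} (h : i < m) :
    column i (m + 1) = 2 ^ 2 ^ m * column i m + column i m := by
  obtain ⟨q, hq⟩ := two_pow_two_pow_add_one_dvd h
  have hs : (2 ^ 2 ^ (m + 1) - 1 : ℕ) = (2 ^ 2 ^ i + 1) * (q * (2 ^ 2 ^ m + 1)) := by
    rw [← mul_assoc, ← hq, pow_succ, pow_mul, mul_comm, ← Nat.sq_sub_sq, one_pow]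
  change (2 ^ 2 ^ (m + 1) - 1) / (2 ^ 2 ^ i + 1) * 2 ^ 2 ^ i =
    2 ^ 2 ^ m * ((2 ^ 2 ^ m - 1) / (2 ^ 2 ^ i + 1) * 2 ^ 2 ^ i) +
      (2 ^ 2 ^ m - 1) / (2 ^ 2 ^ i + 1) * 2 ^ 2 ^ i
  rw [hs, hq, Nat.mul_div_cancel_left _ (by positivity), Nat.mul_div_cancel_left _ (by positivity)]
  ring

theorem column_lt {i m : ℕ} (h : i < m) : column i m < 2 ^ 2 ^ m := by
  obtain ⟨q, hq⟩ := two_pow_two_pow_add_one_dvd h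
  change (2 ^ 2 ^ m - 1) / (2 ^ 2 ^ i + 1) * 2 ^ 2 ^ i < _
  have h1 : (1 : ℕ) ≤ 2 ^ 2 ^ m := Nat.one_le_two_pow
  rw [hq, Nat.mul_div_cancel_left _ (by positivity)]
  calc q * 2 ^ 2 ^ i ≤ (2 ^ 2 ^ i + 1) * q := by nlinarith
    _ < 2 ^ 2 ^ m := by omega

theorem testBit_column {i m s : ℕ} (h : i < m) (hs : s < 2 ^ m) :
    (column i m).testBit s = s.testBit i := by
  induction m, h using Nat.le_induction generalizing s with
  | base =>
    rw [column_top, Nat.testBit_mul_two_pow, Nat.testBit_two_pow_sub_one]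
    rw [Nat.succ_eq_add_one, pow_succ] at hs
    by_cases hi : 2 ^ i ≤ s
    · have : s.testBit i = true := by
        rw [show s = 2 ^ i * 1 + (s - 2 ^ i) by omega, Nat.testBit_two_pow_mul_add _ (by omega)]
        simp
      simp only [this, hi, decide_true, Bool.true_and, decide_eq_true_eq]
      omega
    · rw [Nat.testBit_lt_two_pow (by omega)]
      simp [hi]
  | succ m h ih =>
    rw [column_succ h, Nat.testBit_two_pow_mul_add _ (column_lt h)]
    split_ifs with hlt
    · exact ih hlt
    · rw [pow_succ] at hs
      rw [ih (by omega)]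
      conv_rhs => rw [show s = 2 ^ m * 1 + (s - 2 ^ m) by omega,
        Nat.testBit_two_pow_mul_add _ (by omega)]
      simp [show i < m from h]

/-- A new pair changes the excess by `a - b`, and the shift grows by one, so the index moves from
`d'` to `d' + 1 + a - b`; the equation is arranged to avoid subtraction. The arguments `x` and `y`
are carries from entries already processed. -/
theorem testBit_getD_spread {A B s a b : ℕ} (hA : (A.testBit s).toNat = a)
    (hB : (B.testBit s).toNat = b) (T : List ℕ) (x y d : ℕ) :
    ((spread A B x y T).getD d 0).testBit s ↔
      (d = 0 ∧ x.testBit s) ∨ (d = 1 ∧ y.testBit s) ∨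
        ∃ d', (T.getD d' 0).testBit s ∧ d + b = d' + 1 + a := by
  induction T generalizing x y d with
  | nil =>
    rcases d with _ | _ | d <;> simp [spread]
  | cons t T ih =>
    have hex (n : ℕ) : (∃ d', ((t :: T).getD d' 0).testBit s ∧ n + b = d' + 1 + a) ↔
        (t.testBit s ∧ n + b = 1 + a) ∨
          ∃ d', (T.getD d' 0).testBit s ∧ n + b = d' + 1 + 1 + a := by
      constructor
      · rintro ⟨_ | d', h1, h2⟩
        · exact .inl ⟨by simpa using h1, by omega⟩
        · exact .inr ⟨d', by simpa using h1, h2⟩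
      · rintro (⟨h1, h2⟩ | ⟨d', h1, h2⟩)
        · exact ⟨0, by simpa using h1, by omega⟩
        · exact ⟨d' + 1, by simpa using h1, h2⟩
    rw [hex]
    subst hA hB
    rcases d with _ | d
    · have hno : ¬∃ d', (T.getD d' 0).testBit s ∧
          0 + (B.testBit s).toNat = d' + 1 + 1 + (A.testBit s).toNat := by
        rintro ⟨d', -, h⟩
        have := Bool.toNat_le (B.testBit s)
        omega
      simp only [hno, spread, List.getD_cons_zero]
      change (x ||| (t &&& B) ^^^ (t &&& A &&& B)).testBit s = true ↔ _
      simp only [Nat.testBit_or, Nat.testBit_xor, Nat.testBit_and]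
      cases A.testBit s <;> cases B.testBit s <;> cases t.testBit s <;> simp
    · simp only [spread, List.getD_cons_succ, ih]
      change (d = 0 ∧ (y ||| t ^^^ (t &&& A) ^^^ (t &&& B)).testBit s = true) ∨
        (d = 1 ∧ ((t &&& A) ^^^ (t &&& A &&& B)).testBit s = true) ∨ _ ↔ _
      have hre (d' : ℕ) : d + 1 + (B.testBit s).toNat = d' + 1 + 1 + (A.testBit s).toNat ↔
          d + (B.testBit s).toNat = d' + 1 + (A.testBit s).toNat := by omega
      simp only [hre, Nat.testBit_or, Nat.testBit_xor, Nat.testBit_and]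
      generalize (∃ d', (T.getD d' 0).testBit s = true ∧
        d + (B.testBit s).toNat = d' + 1 + (A.testBit s).toNat) = Q
      cases A.testBit s <;> cases B.testBit s <;> cases t.testBit s <;> simp <;> tauto

/-- The number of pairs whose left coin belongs to the set with code `s`. -/
def leftCount (P : List (ℕ × ℕ)) (s : ℕ) : ℕ := (P.map fun p => (s.testBit p.1).toNat).sum

/-- The number of pairs whose right coin belongs to the set with code `s`. -/
def rightCount (P : List (ℕ × ℕ)) (s : ℕ) : ℕ := (P.map fun p => (s.testBit p.2).toNat).sum

theorem testBit_getD_tally {m s : ℕ} (hs : s < 2 ^ m) (P : List (ℕ × ℕ))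
    (hP : ∀ p ∈ P, p.1 < m ∧ p.2 < m) (T : List ℕ) (d : ℕ) :
    ((tally m P T).getD d 0).testBit s ↔
      ∃ d', (T.getD d' 0).testBit s ∧ d + rightCount P s = d' + P.length + leftCount P s := by
  induction P generalizing T d with
  | nil => simp [tally, leftCount, rightCount]
  | cons p P ih =>
    have hp := hP p (by simp)
    rw [tally, ih (fun q hq => hP q (by simp [hq]))]
    simp only [testBit_getD_spread (congrArg _ (testBit_column hp.1 hs))
      (congrArg _ (testBit_column hp.2 hs)), Nat.zero_testBit, leftCount, rightCount,
      List.map_cons, List.sum_cons, List.length_cons]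
    constructor
    · rintro ⟨d', h1, h2⟩
      simp only [Bool.false_eq_true, and_false, false_or] at h1
      obtain ⟨d'', h3, h4⟩ := h1
      exact ⟨d'', h3, by omega⟩
    · rintro ⟨d'', h3, h4⟩
      have := Bool.toNat_le (s.testBit p.2)
      -- The index after the first pair; the subtraction is not truncated, since a digit is at most
      -- 1.
      exact ⟨d'' + 1 + (s.testBit p.1).toNat - (s.testBit p.2).toNat,
        .inr (.inr ⟨d'', h3, by omega⟩), by omega⟩

theorem testBit_unionAll (T : List ℕ) (s : ℕ) :
    (unionAll T).testBit s ↔ ∃ d, (T.getD d 0).testBit s := by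
  induction T with
  | nil => simp [unionAll]
  | cons t T ih =>
    change (t ||| unionAll T).testBit s = true ↔ _
    rw [Nat.testBit_or, Bool.or_eq_true, ih]
    constructor
    · rintro (h | ⟨d, h⟩)
      · exact ⟨0, by simpa using h⟩
      · exact ⟨d + 1, by simpa using h⟩
    · rintro ⟨_ | d, h⟩
      · exact .inl (by simpa using h)
      · exact .inr ⟨d, by simpa using h⟩

theorem testBit_splitTally (P : List (ℕ × ℕ)) (T : List ℕ) (x s : ℕ) :
    ((splitTally P T x).1.testBit s ↔
      x.testBit s ∨ ∃ d < P.length, (T.getD d 0).testBit s) ∧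
    ((splitTally P T x).2.1.testBit s ↔ (T.getD P.length 0).testBit s) ∧
    ((splitTally P T x).2.2.testBit s ↔ ∃ d > P.length, (T.getD d 0).testBit s) := by
  induction T generalizing P x with
  | nil => cases P <;> simp [splitTally]
  | cons t T ih =>
    cases P with
    | nil =>
      refine ⟨by simp [splitTally], by simp [splitTally], ?_⟩
      simp only [splitTally, testBit_unionAll, List.length_nil]
      constructor
      · rintro ⟨d, h⟩
        exact ⟨d + 1, by omega, by simpa using h⟩
      · rintro ⟨_ | d, h0, h⟩
        · omega
        · exact ⟨d, by simpa using h⟩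
    | cons p P =>
      obtain ⟨h1, h2, h3⟩ := ih P (x ||| t)
      refine ⟨?_, by simpa [splitTally] using h2, ?_⟩
      · change (splitTally P T (x ||| t)).1.testBit s = true ↔ _
        rw [h1, Nat.testBit_or, Bool.or_eq_true, or_assoc]
        refine or_congr_right ⟨?_, ?_⟩
        · rintro (h | ⟨d, hd, h⟩)
          · exact ⟨0, by simp, by simpa using h⟩
          · exact ⟨d + 1, by simpa using hd, by simpa using h⟩
        · rintro ⟨_ | d, hd, h⟩
          · exact .inl (by simpa using h)
          · exact .inr ⟨d, by simpa using hd, by simpa using h⟩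
      · change (splitTally P T (x ||| t)).2.2.testBit s = true ↔ _
        rw [h3]
        constructor
        · rintro ⟨d, hd, h⟩
          exact ⟨d + 1, by simpa using hd, by simpa using h⟩
        · rintro ⟨_ | d, hd, h⟩
          · simp at hd
          · exact ⟨d, by simpa using hd, by simpa using h⟩

/-- After all pairs the shift is `P.length`, so this index means balance, smaller ones a lighter
left pan and larger ones a heavier left pan. -/
theorem testBit_outcomes {m s S : ℕ} (hs : s < 2 ^ m) (P : List (ℕ × ℕ))
    (hP : ∀ p ∈ P, p.1 < m ∧ p.2 < m) (hS : S.testBit s) :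
    (leftCount P s < rightCount P s → (outcomes m P S).1.testBit s) ∧
    (leftCount P s = rightCount P s → (outcomes m P S).2.1.testBit s) ∧
    (rightCount P s < leftCount P s → (outcomes m P S).2.2.testBit s) := by
  have ht (d : ℕ) (hd : d + rightCount P s = P.length + leftCount P s) :
      ((tally m P [S]).getD d 0).testBit s :=
    (testBit_getD_tally hs P hP [S] d).2 ⟨0, by simpa using hS, by omega⟩
  have hr : rightCount P s ≤ P.length := by
    simpa [rightCount] using List.sum_le_card_nsmul (P.map fun p => (s.testBit p.2).toNat) 1
      (List.forall_mem_map.2 fun p _ => Bool.toNat_le _)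
  obtain ⟨h1, h2, h3⟩ := testBit_splitTally P (tally m P [S]) 0 s
  refine ⟨fun h => h1.2 (.inr ⟨P.length + leftCount P s - rightCount P s, by omega, ht _ (by omega)⟩),
    fun h => h2.2 (ht _ (by omega)),
    fun h => h3.2 ⟨P.length + leftCount P s - rightCount P s, by omega, ht _ (by omega)⟩⟩

theorem testBit_constantSets {m s : ℕ} :
    (constantSets m).testBit s ↔ s = 0 ∨ s = 2 ^ m - 1 := by
  change (1 ||| 2 ^ (2 ^ m - 1)).testBit s = true ↔ _
  rw [Nat.testBit_or, Nat.testBit_two_pow, Bool.or_eq_true,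
    Nat.testBit_one_eq_true_iff_self_eq_zero, decide_eq_true_eq, eq_comm (a := 2 ^ m - 1)]

/-- For nonzero `S`, the test `S &&& (S - 1) = 0` recognises powers of two, that is, families with a
single member. -/
theorem settled_iff {m c k S : ℕ} (h : settled m c k S) :
    (∃ s, s ≠ 0 ∧ s ≠ 2 ^ m - 1 ∧ ∀ s', S.testBit s' → s' = s) ∨
      (c ≤ k ∧ ∀ s', S.testBit s' → s' = 0 ∨ s' = 2 ^ m - 1) ∨ S = 0 := by
  simp only [settled, Bool.or_eq_true, Bool.and_eq_true, Nat.beq_eq, Nat.ble_eq] at h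
  obtain rfl | ⟨h1, h2⟩ | ⟨h1, h2⟩ := h
  · simp
  · change S &&& constantSets m = 0 at h1
    change S &&& (S - 1) = 0 at h2
    by_cases h0 : S = 0
    · simp [h0]
    obtain ⟨s, rfl⟩ := (Nat.and_sub_one_eq_zero_iff_isPowerOfTwo h0).1 h2
    have hs : ¬(constantSets m).testBit s := fun h => by
      have := congrArg (·.testBit s) h1
      simp [Nat.testBit_and, h] at this
    rw [testBit_constantSets] at hs
    push Not at hs
    exact .inl ⟨s, hs.1, hs.2, fun s' h => by simpa [Nat.testBit_two_pow, eq_comm] using h⟩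
  · refine .inr (.inl ⟨h1, fun s' h => testBit_constantSets.1 ?_⟩)
    change S ||| constantSets m = constantSets m at h2
    rw [← h2, Nat.testBit_or, h, Bool.true_or]

theorem nodup_of_allDistinct {L : List ℕ} (h : allDistinct L) : L.Nodup := by
  induction L with
  | nil => simp
  | cons a L ih =>
    simp only [allDistinct, Bool.and_eq_true, List.all_eq_true, Bool.not_eq_true'] at h
    refine List.nodup_cons.2 ⟨fun ha => ?_, ih h.2⟩
    simpa using h.1 a ha

open Finset

/-! ### Families of heavy sets that can be told apart within a number of weighings -/

/-- Some strategy with at most `k` weighings sorts the coins whenever the set of the heavier coins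
belongs to the family `𝒮`. -/
def Solvable {n : ℕ} (𝒮 : Set (Finset (Fin n))) (k : ℕ) : Prop :=
  ∃ s : Strategy n, s.weighings ≤ k ∧ ∀ H ∈ 𝒮, ∀ a b : ℝ, 0 < a → a < b →
    SortedBy (s.run fun i => if i ∈ H then b else a) fun i => if i ∈ H then b else a

section Solvable

variable {n : ℕ} {𝒮 𝒯 : Set (Finset (Fin n))} {k l : ℕ}

theorem Solvable.mono (h : Solvable 𝒯 k) (hS : 𝒮 ⊆ 𝒯) (hk : k ≤ l) : Solvable 𝒮 l := by
  obtain ⟨s, hs, h⟩ := h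
  exact ⟨s, hs.trans hk, fun H hH => h H (hS hH)⟩

theorem sortedBy_self (H : Finset (Fin n)) {a b : ℝ} (hab : a < b) :
    SortedBy H fun i => if i ∈ H then b else a := by
  intro i j
  by_cases hi : i ∈ H <;> by_cases hj : j ∈ H <;> simp [hi, hj, hab, hab.le]

theorem solvable_of_forall_eq {P : Finset (Fin n)} (h : ∀ H ∈ 𝒮, H = P) : Solvable 𝒮 0 :=
  ⟨.announce P, le_rfl, fun H hH _ _ _ hab => h H hH ▸ sortedBy_self H hab⟩

/-- Announcing `∅` is right in both cases, as it need not be decided which weight the coins have. -/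
theorem solvable_of_forall_constant (h : ∀ H ∈ 𝒮, H = ∅ ∨ H = univ) : Solvable 𝒮 0 := by
  refine ⟨.announce ∅, le_rfl, fun H hH a b _ _ i j => ?_⟩
  obtain rfl | rfl := h H hH <;> simp [Strategy.run]

theorem solvable_empty : Solvable (∅ : Set (Finset (Fin n))) 0 :=
  solvable_of_forall_eq (P := ∅) (by simp)

theorem sum_weights (A H : Finset (Fin n)) (a b : ℝ) :
    ∑ i ∈ A, (if i ∈ H then b else a) = #A * a + #(A ∩ H) * (b - a) := by
  have h (i : Fin n) : (if i ∈ H then b else a) = a + if i ∈ H then b - a else 0 := by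
    split_ifs <;> ring
  simp only [h, sum_add_distrib, sum_const, nsmul_eq_mul, ← sum_filter, filter_mem_eq_inter]

theorem sum_weights_lt_iff {A B : Finset (Fin n)} (hc : #A = #B) (H : Finset (Fin n)) {a b : ℝ}
    (hab : a < b) :
    ∑ i ∈ A, (if i ∈ H then b else a) < ∑ i ∈ B, (if i ∈ H then b else a) ↔
      #(A ∩ H) < #(B ∩ H) := by
  rw [sum_weights, sum_weights, hc, add_lt_add_iff_left, mul_lt_mul_iff_left₀ (sub_pos.2 hab),
    Nat.cast_lt]

/-- A weighing of two sets with equally many coins. -/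
theorem Solvable.weigh (A B : Finset (Fin n)) (hd : Disjoint A B) (hc : #A = #B)
    (hl : Solvable {H ∈ 𝒮 | #(A ∩ H) < #(B ∩ H)} k) (he : Solvable {H ∈ 𝒮 | #(A ∩ H) = #(B ∩ H)} k)
    (hg : Solvable {H ∈ 𝒮 | #(B ∩ H) < #(A ∩ H)} k) : Solvable 𝒮 (k + 1) := by
  obtain ⟨sl, hl, hl'⟩ := hl
  obtain ⟨se, he, he'⟩ := he
  obtain ⟨sg, hg, hg'⟩ := hg
  refine ⟨.weigh A B hd sl se sg, Nat.succ_le_succ (by simp [hl, he, hg]), fun H hH a b ha hab => ?_⟩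
  simp only [Strategy.run, sum_weights_lt_iff hc H hab, sum_weights_lt_iff hc.symm H hab]
  split_ifs with h1 h2
  · exact hl' H ⟨hH, h1⟩ a b ha hab
  · exact hg' H ⟨hH, h2⟩ a b ha hab
  · exact he' H ⟨hH, by omega⟩ a b ha hab

/-- A weighing of one coin against another one. -/
theorem Solvable.weigh_single {x y : Fin n} (hxy : x ≠ y)
    (hl : Solvable {H ∈ 𝒮 | x ∉ H ∧ y ∈ H} k) (he : Solvable {H ∈ 𝒮 | x ∈ H ↔ y ∈ H} k)
    (hg : Solvable {H ∈ 𝒮 | x ∈ H ∧ y ∉ H} k) : Solvable 𝒮 (k + 1) := by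
  have hc (z : Fin n) (H : Finset (Fin n)) : #({z} ∩ H) = if z ∈ H then 1 else 0 := by
    split_ifs with h <;> simp [h]
  refine .weigh {x} {y} (by simpa using hxy) (by simp) (hl.mono ?_ le_rfl) (he.mono ?_ le_rfl)
    (hg.mono ?_ le_rfl) <;>
  · rintro H ⟨hH, h⟩
    refine ⟨hH, ?_⟩
    rw [hc, hc] at h
    by_cases hx : x ∈ H <;> by_cases hy : y ∈ H <;> simp_all

/-- A weighing of a coin that is known to be light against another one. -/
theorem Solvable.weigh_light {x y : Fin n} (hxy : x ≠ y) (hx : ∀ H ∈ 𝒮, x ∉ H)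
    (hy : Solvable {H ∈ 𝒮 | y ∈ H} k) (hy' : Solvable {H ∈ 𝒮 | y ∉ H} k) : Solvable 𝒮 (k + 1) := by
  refine .weigh_single hxy (hy.mono ?_ le_rfl) (hy'.mono ?_ le_rfl) (hy.mono ?_ le_rfl)
  · exact fun H h => ⟨h.1, h.2.2⟩
  · exact fun H h => ⟨h.1, fun h' => hx H h.1 (h.2.2 h')⟩
  · exact fun H h => (hx H h.1 h.2.1).elim

end Solvable

/-! ### Sorting a block of coins -/

/-- Any block of `m` coins can be sorted with `k` weighings on the coins in the block, and with `c`
weighings less if all coins in the block have the same weight. The statement is about all ways to go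
on with `j` more weighings for the remaining coins. -/
def SortableBlock (m c k : ℕ) : Prop :=
  ∀ ⦃n : ℕ⦄ (M : Finset (Fin n)) (𝒮 : Set (Finset (Fin n))) (j : ℕ), #M = m →
    (∀ P ⊆ M, P ≠ ∅ → P ≠ M → Solvable {H ∈ 𝒮 | M ∩ H = P} j) →
    Solvable {H ∈ 𝒮 | M ∩ H = ∅ ∨ M ∩ H = M} (j + c) → Solvable 𝒮 (k + j)

/-! ### From checked schemes to sortable blocks -/

section Scheme

variable {n m : ℕ}

/-- The code of the set of those indices below `m` for which the coin `e i` belongs to `H`. -/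
def code (m : ℕ) (e : ℕ → Fin n) (H : Finset (Fin n)) : ℕ :=
  Nat.ofBits fun i : Fin m => decide (e i ∈ H)

theorem code_lt (e : ℕ → Fin n) (H : Finset (Fin n)) : code m e H < 2 ^ m :=
  Nat.ofBits_lt_two_pow _

theorem testBit_code (e : ℕ → Fin n) (H : Finset (Fin n)) {i : ℕ} (hi : i < m) :
    (code m e H).testBit i = decide (e i ∈ H) :=
  Nat.testBit_ofBits_lt _ _ hi

theorem card_image_inter (e : ℕ → Fin n) {L : List ℕ} (hL : L.Nodup) (hm : ∀ i ∈ L, i < m)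
    (he : Set.InjOn e {i | i < m}) (H : Finset (Fin n)) :
    #(L.toFinset.image e ∩ H) = (L.map fun i => ((code m e H).testBit i).toNat).sum := by
  induction L with
  | nil => simp
  | cons a L ih =>
    rw [List.nodup_cons] at hL
    have ha : e a ∉ L.toFinset.image e := by
      simp only [mem_image, List.mem_toFinset, not_exists, not_and]
      intro i hi h
      exact hL.1 (he (hm i (by simp [hi])) (hm a (by simp)) h ▸ hi)
    rw [List.toFinset_cons, image_insert, List.map_cons, List.sum_cons,
      ← ih hL.2 fun i hi => hm i (by simp [hi]), testBit_code e H (hm a (by simp))]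
    by_cases h : e a ∈ H
    · rw [insert_inter_of_mem h, card_insert_of_notMem (by simp [ha])]
      simp [h, add_comm]
    · rw [insert_inter_of_notMem h]
      simp [h]

/-- Soundness of the check, by induction on the scheme. At a settled leaf the play continues with
`h1` or `h2`; a constant leaf still has at least `c` of the `k` weighings left, which covers the `j
+ c` required by `h2`. -/
theorem Scheme.solvable {c j : ℕ} {e : ℕ → Fin n} (he : Set.InjOn e {i | i < m})
    {𝒮 : Set (Finset (Fin n))}
    (h1 : ∀ s, s ≠ 0 → s ≠ 2 ^ m - 1 → Solvable {H ∈ 𝒮 | code m e H = s} j)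
    (h2 : Solvable {H ∈ 𝒮 | code m e H = 0 ∨ code m e H = 2 ^ m - 1} (j + c)) (t : Scheme) :
    ∀ k S, t.check m c k S → Solvable {H ∈ 𝒮 | S.testBit (code m e H)} (k + j) := by
  induction t with
  | done =>
    intro k S h
    obtain ⟨s, hs0, hs1, hs⟩ | ⟨hc, hs⟩ | rfl := settled_iff h
    · exact (h1 s hs0 hs1).mono (fun H hH => ⟨hH.1, hs _ hH.2⟩) (by omega)
    · exact h2.mono (fun H hH => ⟨hH.1, hs _ hH.2⟩) (by omega)
    · exact solvable_empty.mono (fun H hH => by simp at hH) (by omega)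
  | weigh P l q g ihl ihe ihg =>
    intro k S h
    obtain _ | k := k
    · simp [Scheme.check] at h
    simp only [Scheme.check, Bool.and_eq_true, List.all_eq_true, Nat.blt_eq] at h
    obtain ⟨⟨hnd, hlt⟩, ⟨hl, hq⟩, hg⟩ := h
    obtain ⟨hn1, hn2, hdj⟩ := List.nodup_append.1 (nodup_of_allDistinct hnd)
    have hm1 : ∀ i ∈ P.map Prod.fst, i < m := List.forall_mem_map.2 fun p hp => (hlt p hp).1
    have hm2 : ∀ i ∈ P.map Prod.snd, i < m := List.forall_mem_map.2 fun p hp => (hlt p hp).2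
    have hA (H : Finset (Fin n)) : #((P.map Prod.fst).toFinset.image e ∩ H) =
        leftCount P (code m e H) := by
      rw [card_image_inter e hn1 hm1 he, List.map_map]; rfl
    have hB (H : Finset (Fin n)) : #((P.map Prod.snd).toFinset.image e ∩ H) =
        rightCount P (code m e H) := by
      rw [card_image_inter e hn2 hm2 he, List.map_map]; rfl
    rw [add_right_comm]
    refine .weigh ((P.map Prod.fst).toFinset.image e) ((P.map Prod.snd).toFinset.image e) ?_ ?_
      ((ihl k _ hl).mono ?_ le_rfl) ((ihe k _ hq).mono ?_ le_rfl) ((ihg k _ hg).mono ?_ le_rfl)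
    · rw [disjoint_left]
      simp only [mem_image, List.mem_toFinset]
      rintro _ ⟨i, hi, rfl⟩ ⟨i', hi', h⟩
      exact hdj i hi i' hi' (he (hm1 i hi) (hm2 i' hi') h.symm)
    · rw [card_image_of_injOn fun i hi i' hi' => he (hm1 i (by simpa using hi))
        (hm1 i' (by simpa using hi')), card_image_of_injOn fun i hi i' hi' =>
        he (hm2 i (by simpa using hi)) (hm2 i' (by simpa using hi')),
        List.toFinset_card_of_nodup hn1, List.toFinset_card_of_nodup hn2]
      simp
    · rintro H ⟨⟨hH, hS⟩, h⟩
      exact ⟨hH, (testBit_outcomes (code_lt e H) P hlt hS).1 (by rwa [hA, hB] at h)⟩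
    · rintro H ⟨⟨hH, hS⟩, h⟩
      exact ⟨hH, (testBit_outcomes (code_lt e H) P hlt hS).2.1 (by rwa [hA, hB] at h)⟩
    · rintro H ⟨⟨hH, hS⟩, h⟩
      exact ⟨hH, (testBit_outcomes (code_lt e H) P hlt hS).2.2 (by rwa [hA, hB] at h)⟩

theorem testBit_allSets {s : ℕ} (hs : s < 2 ^ m) : (allSets m).testBit s := by
  change (2 ^ 2 ^ m - 1).testBit s = true
  simpa [Nat.testBit_two_pow_sub_one] using hs

theorem SortableBlock.of_checkList {c k : ℕ} {L : List ℕ} (hm : 0 < m)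
    (h : checkList m c k L = true) : SortableBlock m c k := by
  intro n M 𝒮 j hM h1 h2
  obtain ⟨x, -⟩ := card_pos.1 (hM ▸ hm)
  -- The value `x` for indices from `m` on is a dummy; checked schemes only use indices below `m`.
  let e (i : ℕ) : Fin n := if hi : i < m then M.orderEmbOfFin hM ⟨i, hi⟩ else x
  have heq {i : ℕ} (hi : i < m) : e i = M.orderEmbOfFin hM ⟨i, hi⟩ := dif_pos hi
  have he : Set.InjOn e {i | i < m} := by
    intro i hi i' hi' h
    rw [heq hi, heq hi', EmbeddingLike.apply_eq_iff_eq, Fin.mk.injEq] at h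
    exact h
  have hmem {i : ℕ} (hi : i < m) : e i ∈ M := heq hi ▸ M.orderEmbOfFin_mem hM _
  have hsurj {y : Fin n} (hy : y ∈ M) : ∃ i < m, e i = y := by
    rw [← mem_coe, ← M.range_orderEmbOfFin hM] at hy
    obtain ⟨i, rfl⟩ := hy
    exact ⟨i, i.2, heq i.2⟩
  have hbit {s i : ℕ} (hi : i < m) {H : Finset (Fin n)} (hH : code m e H = s) :
      s.testBit i ↔ e i ∈ H := by
    rw [← hH, testBit_code e H hi, decide_eq_true_eq]
  have key (s : ℕ) (H : Finset (Fin n)) (hH : code m e H = s) :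
      M ∩ H = {y ∈ M | ∃ i < m, e i = y ∧ s.testBit i} := by
    ext y
    simp only [mem_inter, mem_filter, and_congr_right_iff]
    intro hy
    obtain ⟨i, hi, rfl⟩ := hsurj hy
    constructor
    · exact fun h => ⟨i, hi, rfl, (hbit hi hH).2 h⟩
    · rintro ⟨i', hi', h, hs⟩
      exact h ▸ (hbit hi' hH).1 hs
  have hfull {i : ℕ} (hi : i < m) : (2 ^ m - 1).testBit i := by
    simpa [Nat.testBit_two_pow_sub_one] using hi
  have := Scheme.solvable (j := j) (c := c) he (𝒮 := 𝒮) ?_ (h2.mono ?_ le_rfl) _ k (allSets m) h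
  · exact this.mono (fun H hH => ⟨hH, testBit_allSets (code_lt e H)⟩) le_rfl
  · intro s hs0 hs1
    by_cases hs : s < 2 ^ m
    · refine (h1 {y ∈ M | ∃ i < m, e i = y ∧ s.testBit i} (filter_subset _ _) ?_ ?_).mono
        (fun H hH => ⟨hH.1, key s H hH.2⟩) le_rfl
      · intro h0
        refine hs0 (Nat.eq_of_testBit_eq fun i => ?_)
        rw [Nat.zero_testBit, Bool.eq_false_iff]
        intro hi
        have him : i < m := by
          by_contra! hmi
          rw [Nat.testBit_lt_two_pow (hs.trans_le (Nat.pow_le_pow_right two_pos hmi))] at hi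
          simp at hi
        exact notMem_empty (e i) (h0 ▸ mem_filter.2 ⟨hmem him, i, him, rfl, hi⟩)
      · intro h0
        refine hs1 (Nat.eq_of_testBit_eq fun i => ?_)
        rw [Nat.testBit_two_pow_sub_one]
        by_cases him : i < m
        · have := h0.symm ▸ hmem him
          obtain ⟨-, i', hi', h, hs⟩ := mem_filter.1 this
          rw [← he hi' him h, hs, decide_eq_true hi']
        · rw [Nat.testBit_lt_two_pow (hs.trans_le (Nat.pow_le_pow_right two_pos (by omega))),
            decide_eq_false him]
    · exact solvable_empty.mono (fun H hH => (hs (hH.2 ▸ code_lt e H)).elim) (Nat.zero_le _)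
  · rintro H ⟨hH, h | h⟩
    · refine ⟨hH, .inl ?_⟩
      simp [key 0 H h]
    · refine ⟨hH, .inr ?_⟩
      rw [key _ H h, filter_eq_self]
      intro y hy
      obtain ⟨i, hi, rfl⟩ := hsurj hy
      exact ⟨i, hi, rfl, hfull hi⟩

end Scheme

/-- Any block of `m` coins can be sorted with `k` weighings in the presence of another coin that is
known to be light. -/
def SortableWithLight (m k : ℕ) : Prop :=
  ∀ ⦃n : ℕ⦄ (M : Finset (Fin n)) (𝒮 : Set (Finset (Fin n))) (j : ℕ) (x : Fin n), #M = m → x ∉ M →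
    (∀ H ∈ 𝒮, x ∉ H) → (∀ P ⊆ M, Solvable {H ∈ 𝒮 | M ∩ H = P} j) → Solvable 𝒮 (k + j)

/-- Any block of `m` coins can be sorted with `k` weighings, together with at least two other coins
that are known to have the same weight. If all these coins have the same weight, then one weighing
less is needed. -/
def SortableWithEqual (m k : ℕ) : Prop :=
  ∀ ⦃n : ℕ⦄ (N M : Finset (Fin n)) (𝒮 : Set (Finset (Fin n))) (j : ℕ), 2 ≤ #N → Disjoint N M →
    #M = m → (∀ H ∈ 𝒮, N ∩ H = ∅ ∨ N ∩ H = N) →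
    (∀ P ⊆ N ∪ M, P ≠ ∅ → P ≠ N ∪ M → Solvable {H ∈ 𝒮 | (N ∪ M) ∩ H = P} j) →
    Solvable {H ∈ 𝒮 | (N ∪ M) ∩ H = ∅ ∨ (N ∪ M) ∩ H = N ∪ M} (j + 1) → Solvable 𝒮 (k + j)

/-! ### Combining blocks -/

theorem SortableWithEqual.mono {m k l : ℕ} (h : SortableWithEqual m k) (hkl : k ≤ l) :
    SortableWithEqual m l := fun _ N M 𝒮 j hN hd hM h𝒮 hP hc =>
  (h N M 𝒮 j hN hd hM h𝒮 hP hc).mono subset_rfl (by omega)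

theorem inter_eq_of_union_inter_eq {α : Type*} [DecidableEq α] {A B H P Q : Finset α}
    (hA : A ∩ H = P) (hB : B ∩ H = Q) : (A ∪ B) ∩ H = P ∪ Q := by
  rw [union_inter_distrib_right, hA, hB]

theorem sortableWithLight_one : SortableWithLight 1 1 := by
  intro n M 𝒮 j x hM hx h𝒮 hP
  obtain ⟨y, rfl⟩ := card_eq_one.1 hM
  rw [add_comm]
  refine .weigh_light (y := y) (fun h => hx (by simp [h])) h𝒮 ((hP {y} subset_rfl).mono ?_ le_rfl)
    ((hP ∅ (empty_subset _)).mono ?_ le_rfl)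
  · exact fun H hH => ⟨hH.1, singleton_inter_of_mem hH.2⟩
  · exact fun H hH => ⟨hH.1, singleton_inter_of_notMem hH.2⟩

theorem SortableWithLight.add {a b k l : ℕ} (ha : SortableWithLight a k)
    (hb : SortableWithLight b l) : SortableWithLight (a + b) (k + l) := by
  intro n M 𝒮 j x hM hx h𝒮 hP
  obtain ⟨A, hAM, hA⟩ := exists_subset_card_eq (hM ▸ Nat.le_add_right a b)
  have hB : #(M \ A) = b := by rw [card_sdiff_of_subset hAM]; omega
  rw [add_assoc]
  refine ha A 𝒮 (l + j) x hA (fun h => hx (hAM h)) h𝒮 fun P hPA => ?_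
  refine hb (M \ A) _ j x hB (fun h => hx (sdiff_subset h)) (fun H hH => h𝒮 H hH.1) fun Q hQ => ?_
  refine (hP (P ∪ Q) (union_subset (hPA.trans hAM) (hQ.trans sdiff_subset))).mono ?_ le_rfl
  rintro H ⟨⟨hH, h1⟩, h2⟩
  exact ⟨hH, by rw [← inter_eq_of_union_inter_eq h1 h2, union_sdiff_of_subset hAM]⟩

/-- If the block is constant, the weighing saved is spent on comparing one of its coins with the
light coin, which separates all light from all heavy. -/
theorem SortableBlock.withLight {m k : ℕ} (h : SortableBlock m 1 k) (hm : 0 < m) :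
    SortableWithLight m k := by
  intro n M 𝒮 j x hM hx h𝒮 hP
  obtain ⟨y, hy⟩ := card_pos.1 (hM ▸ hm)
  refine h M 𝒮 j hM (fun P hP' _ _ => hP P hP') ?_
  refine .weigh_light (x := x) (y := y) (fun h => hx (h ▸ hy)) (fun H hH => h𝒮 H hH.1)
    ((hP M subset_rfl).mono ?_ le_rfl) ((hP ∅ (empty_subset _)).mono ?_ le_rfl)
  · rintro H ⟨⟨hH, h | h⟩, hyH⟩
    · exact (notMem_empty y (h ▸ mem_inter.2 ⟨hy, hyH⟩)).elim
    · exact ⟨hH, h⟩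
  · rintro H ⟨⟨hH, h | h⟩, hyH⟩
    · exact ⟨hH, h⟩
    · exact (hyH (inter_eq_left.1 h hy)).elim

/-- One comparison of the new coin with an old one decides everything. The second weighing only
provides the saving required when all coins are equal. -/
theorem sortableWithEqual_one : SortableWithEqual 1 2 := by
  intro n N M 𝒮 j hN hd hM h𝒮 hP hc
  obtain ⟨y, rfl⟩ := card_eq_one.1 hM
  obtain ⟨x, hx⟩ := card_pos.1 (two_pos.trans_le hN)
  rw [disjoint_singleton_right] at hd
  have hyN {H : Finset (Fin n)} (h : y ∈ H) : {y} ∩ H = {y} := by simpa using h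
  have hyN' {H : Finset (Fin n)} (h : y ∉ H) : {y} ∩ H = ∅ := singleton_inter_of_notMem h
  have hN0 {H : Finset (Fin n)} (hH : H ∈ 𝒮) (h : x ∉ H) : N ∩ H = ∅ :=
    (h𝒮 H hH).resolve_right fun h' => h (inter_eq_left.1 h' hx)
  have hN1 {H : Finset (Fin n)} (hH : H ∈ 𝒮) (h : x ∈ H) : N ∩ H = N :=
    (h𝒮 H hH).resolve_left fun h' => notMem_empty x (h' ▸ mem_inter.2 ⟨hx, h⟩)
  rw [show 2 + j = j + 1 + 1 by omega]
  refine .weigh_single (x := x) (y := y) (fun h => hd (h ▸ hx)) ?_ (hc.mono ?_ le_rfl) ?_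
  · refine (hP {y} subset_union_right (by simp) fun h => ?_).mono ?_ (Nat.le_succ j)
    · exact hd (mem_singleton.1 (h ▸ mem_union_left _ hx) ▸ hx)
    · rintro H ⟨hH, hxH, hyH⟩
      exact ⟨hH, by rw [inter_eq_of_union_inter_eq (hN0 hH hxH) (hyN hyH), empty_union]⟩
  · rintro H ⟨hH, h⟩
    by_cases hyH : y ∈ H
    · exact ⟨hH, .inr (inter_eq_of_union_inter_eq (hN1 hH (h.2 hyH)) (hyN hyH))⟩
    · exact ⟨hH, .inl (inter_eq_of_union_inter_eq (hN0 hH (mt h.1 hyH)) (hyN' hyH))⟩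
  · refine (hP N subset_union_left (ne_empty_of_mem hx) fun h => ?_).mono ?_ (Nat.le_succ j)
    · exact hd (h ▸ mem_union_right _ (mem_singleton_self y))
    · rintro H ⟨hH, hxH, hyH⟩
      exact ⟨hH, by rw [inter_eq_of_union_inter_eq (hN1 hH hxH) (hyN' hyH), union_empty]⟩

/-- Two of the equal coins are weighed against two new coins `x`, `y`. Balance makes `x` and `y`
equal to the old coins, and `h` continues with a larger set of equal coins. Otherwise the type of
the old coins is revealed, weighing `x` against `y` settles these two, and a light coin is available
for the remaining `m` coins. -/
theorem SortableWithEqual.add_two {m k : ℕ} (h : SortableWithEqual m (k + 1))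
    (hl : SortableWithLight m k) : SortableWithEqual (m + 2) (k + 2) := by
  intro n N M 𝒮 j hN hd hM h𝒮 hP hc
  obtain ⟨A, hAM, hA⟩ := exists_subset_card_eq (hM ▸ Nat.le_add_left 2 m)
  obtain ⟨B, hBN, hB⟩ := exists_subset_card_eq hN
  have hMA : #(M \ A) = m := by rw [card_sdiff_of_subset hAM]; omega
  obtain ⟨x, y, hxy, rfl⟩ := card_eq_two.1 hA
  have hxM : x ∈ M := hAM (by simp)
  have hyM : y ∈ M := hAM (by simp)
  obtain ⟨z, hz⟩ := card_pos.1 (two_pos.trans_le hN)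
  have hunion : N ∪ {x, y} ∪ M \ {x, y} = N ∪ M := by
    rw [union_assoc, union_sdiff_of_subset hAM]
  have hBH {H : Finset (Fin n)} (hH : H ∈ 𝒮) :
      (N ∩ H = ∅ ∧ B ∩ H = ∅) ∨ (N ∩ H = N ∧ B ∩ H = B) := by
    obtain h | h := h𝒮 H hH
    · exact .inl ⟨h, subset_empty.1 (h ▸ inter_subset_inter_right hBN)⟩
    · exact .inr ⟨h, inter_eq_left.2 (hBN.trans (inter_eq_left.1 h))⟩
  -- The common end of the six unbalanced cases: `N ∪ {x, y}` is sorted, `u` is a light reference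
  -- coin, and `u`, `v` together exclude the constant patterns, so `hP` applies.
  have finish {𝒯 : Set (Finset (Fin n))} (h𝒯 : 𝒯 ⊆ 𝒮) (u v : Fin n) (hu : u ∈ N ∪ {x, y})
      (hv : v ∈ N ∪ {x, y}) (huH : ∀ H ∈ 𝒯, u ∉ H) (hvH : ∀ H ∈ 𝒯, v ∈ H) (Q : Finset (Fin n))
      (hQ : ∀ H ∈ 𝒯, (N ∪ {x, y}) ∩ H = Q) : Solvable 𝒯 (k + j) := by
    obtain rfl | ⟨H₀, hH₀⟩ := 𝒯.eq_empty_or_nonempty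
    · exact solvable_empty.mono subset_rfl (Nat.zero_le _)
    refine hl (M \ {x, y}) 𝒯 j u hMA ?_ huH fun P hPM => ?_
    · intro h
      rw [mem_sdiff] at h
      exact (mem_union.1 hu).elim (fun h' => disjoint_left.1 hd h' h.1) h.2
    have huP : u ∉ P := fun h => by
      have := hPM h
      rw [mem_sdiff] at this
      exact (mem_union.1 hu).elim (fun h' => disjoint_left.1 hd h' this.1) this.2
    have hQ₀ := hQ H₀ hH₀
    refine (hP (Q ∪ P) ?_ ?_ ?_).mono ?_ le_rfl
    · rw [← hunion, ← hQ₀]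
      exact union_subset_union inter_subset_left hPM
    · exact ne_empty_of_mem (mem_union_left _ (hQ₀ ▸ mem_inter.2 ⟨hv, hvH H₀ hH₀⟩))
    · intro h
      have hu' : u ∈ Q ∪ P := h ▸ hunion ▸ mem_union_left _ hu
      rw [mem_union, ← hQ₀, mem_inter] at hu'
      exact hu'.elim (fun h' => huH H₀ hH₀ h'.2) huP
    · rintro H ⟨hH, h'⟩
      exact ⟨h𝒯 hH, by rw [← hunion, inter_eq_of_union_inter_eq (hQ H hH) h']⟩
  rw [show k + 2 + j = k + j + 1 + 1 by omega]
  refine .weigh B {x, y} (hd.mono hBN hAM) (hB.trans hA.symm) ?_ ?_ ?_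
  · have hx0 {H : Finset (Fin n)} (hH : H ∈ 𝒮) (hlt : #(B ∩ H) < #({x, y} ∩ H)) : N ∩ H = ∅ := by
      obtain ⟨h, -⟩ | ⟨-, h⟩ := hBH hH
      · exact h
      · rw [h, hB, ← hA] at hlt
        exact (hlt.not_ge (card_le_card inter_subset_left)).elim
    refine .weigh_single hxy ?_ ?_ ?_
    · refine finish (fun H hH => hH.1.1) x y (by simp) (by simp) (fun H hH => hH.2.1)
        (fun H hH => hH.2.2) {y} fun H hH => ?_
      rw [inter_eq_of_union_inter_eq (hx0 hH.1.1 hH.1.2) rfl, empty_union,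
        insert_inter_of_notMem hH.2.1, singleton_inter_of_mem hH.2.2]
    -- The pan with `x` and `y` contains a heavy coin, so if they balance both are heavy.
    · have hxH {H : Finset (Fin n)} (hlt : #(B ∩ H) < #({x, y} ∩ H)) (hiff : x ∈ H ↔ y ∈ H) :
          x ∈ H := by
        by_contra hx
        simp [hx, mt hiff.2 hx] at hlt
      refine finish (fun H hH => hH.1.1) z x (mem_union_left _ hz) (by simp)
        (fun H hH hzH => notMem_empty z (hx0 hH.1.1 hH.1.2 ▸ mem_inter.2 ⟨hz, hzH⟩))
        (fun H hH => hxH hH.1.2 hH.2) {x, y} fun H hH => ?_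
      have := hxH hH.1.2 hH.2
      rw [inter_eq_of_union_inter_eq (hx0 hH.1.1 hH.1.2) rfl, empty_union,
        insert_inter_of_mem this, singleton_inter_of_mem (hH.2.1 this)]
    · refine finish (fun H hH => hH.1.1) y x (by simp) (by simp) (fun H hH => hH.2.2)
        (fun H hH => hH.2.1) {x} fun H hH => ?_
      rw [inter_eq_of_union_inter_eq (hx0 hH.1.1 hH.1.2) rfl, empty_union,
        insert_inter_of_mem hH.2.1, singleton_inter_of_notMem hH.2.2]
      simp
  · rw [add_right_comm]
    refine h (N ∪ {x, y}) (M \ {x, y}) _ j (hN.trans (card_le_card subset_union_left)) ?_ hMA ?_ ?_ ?_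
    · rw [disjoint_union_left]
      exact ⟨hd.mono_right sdiff_subset, disjoint_sdiff⟩
    · rintro H ⟨hH, heq⟩
      obtain ⟨h1, h2⟩ | ⟨h1, h2⟩ := hBH hH
      · rw [h2, card_empty, eq_comm, card_eq_zero] at heq
        exact .inl (inter_eq_of_union_inter_eq h1 heq)
      · rw [h2, hB, ← hA] at heq
        exact .inr (inter_eq_of_union_inter_eq h1 (eq_of_subset_of_card_le inter_subset_left heq.le))
    · rw [hunion]
      exact fun P h1 h2 h3 => (hP P h1 h2 h3).mono (fun H hH => ⟨hH.1.1, hH.2⟩) le_rfl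
    · rw [hunion]
      exact hc.mono (fun H hH => ⟨hH.1.1, hH.2⟩) le_rfl
  · have hx1 {H : Finset (Fin n)} (hH : H ∈ 𝒮) (hlt : #({x, y} ∩ H) < #(B ∩ H)) : N ∩ H = N := by
      obtain ⟨-, h⟩ | ⟨h, -⟩ := hBH hH
      · simp [h] at hlt
      · exact h
    have hzH {H : Finset (Fin n)} (hH : H ∈ 𝒮) (hlt : #({x, y} ∩ H) < #(B ∩ H)) : z ∈ H :=
      inter_eq_left.1 (hx1 hH hlt) hz
    refine .weigh_single hxy ?_ ?_ ?_
    · refine finish (fun H hH => hH.1.1) x z (by simp) (mem_union_left _ hz) (fun H hH => hH.2.1)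
        (fun H hH => hzH hH.1.1 hH.1.2) (N ∪ {y}) fun H hH => ?_
      rw [inter_eq_of_union_inter_eq (hx1 hH.1.1 hH.1.2) rfl,
        insert_inter_of_notMem hH.2.1, singleton_inter_of_mem hH.2.2]
    · have hxH {H : Finset (Fin n)} (hlt : #({x, y} ∩ H) < #(B ∩ H)) (hiff : x ∈ H ↔ y ∈ H) :
          x ∉ H := by
        intro hx
        have := hlt.trans_le (card_le_card inter_subset_left)
        simp [hx, hiff.1 hx, hB, hA] at this
      refine finish (fun H hH => hH.1.1) x z (by simp) (mem_union_left _ hz)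
        (fun H hH => hxH hH.1.2 hH.2) (fun H hH => hzH hH.1.1 hH.1.2) N fun H hH => ?_
      have := hxH hH.1.2 hH.2
      rw [inter_eq_of_union_inter_eq (hx1 hH.1.1 hH.1.2) rfl,
        insert_inter_of_notMem this, singleton_inter_of_notMem (mt hH.2.2 this), union_empty]
    · refine finish (fun H hH => hH.1.1) y z (by simp) (mem_union_left _ hz) (fun H hH => hH.2.2)
        (fun H hH => hzH hH.1.1 hH.1.2) (N ∪ {x}) fun H hH => ?_
      rw [inter_eq_of_union_inter_eq (hx1 hH.1.1 hH.1.2) rfl,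
        insert_inter_of_mem hH.2.1, singleton_inter_of_notMem hH.2.2]
      simp

/-- If the first `a` coins are not all equal, one of them is a light reference coin and `hl` sorts
the rest. If they are equal, the weighing saved raises the budget for the rest to `l + 1`, as `he`
needs, and `he` again saves one weighing when all coins are equal. -/
theorem SortableBlock.add {a b k l : ℕ} (ha : SortableBlock a 1 k) (h2 : 2 ≤ a)
    (hl : SortableWithLight b l) (he : SortableWithEqual b (l + 1)) :
    SortableBlock (a + b) 1 (k + l) := by
  intro n M 𝒮 j hM hP hc
  obtain ⟨A, hAM, hA⟩ := exists_subset_card_eq (hM ▸ Nat.le_add_right a b)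
  have hB : #(M \ A) = b := by rw [card_sdiff_of_subset hAM]; omega
  have hAB : A ∪ M \ A = M := union_sdiff_of_subset hAM
  rw [add_assoc]
  refine ha A 𝒮 (l + j) hA (fun P hPA hP0 hP1 => ?_) ?_
  · obtain ⟨x, hxA, hxP⟩ := exists_of_ssubset (hPA.ssubset_of_ne hP1)
    refine hl (M \ A) _ j x hB (fun h => (mem_sdiff.1 h).2 hxA)
      (fun H hH hx => hxP (hH.2 ▸ mem_inter.2 ⟨hxA, hx⟩)) fun Q hQ => ?_
    refine (hP (P ∪ Q) (union_subset (hPA.trans hAM) (hQ.trans sdiff_subset)) ?_ ?_).mono ?_ le_rfl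
    · exact fun h => hP0 (union_eq_empty.1 h).1
    · intro h
      exact (mem_union.1 (h.symm ▸ hAM hxA)).elim hxP fun h' => (mem_sdiff.1 (hQ h')).2 hxA
    · rintro H ⟨⟨hH, h1⟩, h2⟩
      exact ⟨hH, by rw [← inter_eq_of_union_inter_eq h1 h2, hAB]⟩
  · rw [add_right_comm]
    refine he A (M \ A) _ j (hA ▸ h2) disjoint_sdiff hB (fun H hH => hH.2) ?_ ?_
    · rw [hAB]
      exact fun P h1 h2 h3 => (hP P h1 h2 h3).mono (fun H hH => ⟨hH.1.1, hH.2⟩) le_rfl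
    · rw [hAB]
      exact hc.mono (fun H hH => ⟨hH.1.1, hH.2⟩) le_rfl

theorem SortableBlock.solvable_univ {n c k : ℕ} (h : SortableBlock n c k) :
    Solvable (Set.univ : Set (Finset (Fin n))) k := by
  refine h univ Set.univ 0 (by simp) (fun P _ _ _ => solvable_of_forall_eq (P := P) ?_)
    ((solvable_of_forall_constant ?_).mono subset_rfl (Nat.zero_le _))
  · simp
  · simp

/-! ### The upper bound -/

theorem sortableBlock_four : SortableBlock 4 1 3 := .of_checkList (by decide) checkList_four

theorem sortableBlock_six : SortableBlock 6 1 4 := .of_checkList (by decide) checkList_six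

theorem sortableBlock_nine : SortableBlock 9 1 6 := .of_checkList (by decide) checkList_nine

theorem sortableBlock_eleven : SortableBlock 11 1 7 := .of_checkList (by decide) checkList_eleven

theorem sortableBlock_fourteen : SortableBlock 14 1 9 := .of_checkList (by decide) checkList_fourteen

theorem SortableBlock.add_one {m k : ℕ} (h : SortableBlock m 1 k) (hm : 2 ≤ m) :
    SortableBlock (m + 1) 1 (k + 1) :=
  h.add hm sortableWithLight_one sortableWithEqual_one

theorem sortableWithEqual_eleven : SortableWithEqual 11 8 := by
  have l1 := sortableWithLight_one
  have l3 : SortableWithLight 3 3 := (l1.add l1).add l1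
  have l5 : SortableWithLight 5 4 := (sortableBlock_four.withLight (by decide)).add l1
  have l7 : SortableWithLight 7 5 := (sortableBlock_six.withLight (by decide)).add l1
  have l9 : SortableWithLight 9 6 := sortableBlock_nine.withLight (by decide)
  have e3 : SortableWithEqual 3 3 := sortableWithEqual_one.add_two l1
  -- One weighing is given away here, because `l3` takes three weighings and `add_two` needs
  -- matching budgets.
  have e5 : SortableWithEqual 5 5 := (e3.mono (by decide)).add_two l3
  exact ((e5.add_two l5).add_two l7).add_two l9

theorem SortableBlock.add_eleven {m k : ℕ} (h : SortableBlock m 1 k) (hm : 2 ≤ m) :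
    SortableBlock (m + 11) 1 (k + 7) :=
  h.add hm (sortableBlock_eleven.withLight (by decide)) sortableWithEqual_eleven

/-- The bound is `⌈7n/11⌉`, which grows by exactly 7 when `n` grows by 11. Among the sizes 4 to 14,
those without a scheme of their own arise by adding single coins at one weighing each. -/
theorem sortableBlock_of_four_le (n : ℕ) (hn : 4 ≤ n) : SortableBlock n 1 ((7 * n + 10) / 11) := by
  induction n using Nat.strong_induction_on with
  | _ n ih =>
    by_cases h : n < 15
    · interval_cases n
      · exact sortableBlock_four
      · exact sortableBlock_four.add_one (by decide)
      · exact sortableBlock_six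
      · exact sortableBlock_six.add_one (by decide)
      · exact (sortableBlock_six.add_one (by decide)).add_one (by decide)
      · exact sortableBlock_nine
      · exact sortableBlock_nine.add_one (by decide)
      · exact sortableBlock_eleven
      · exact sortableBlock_eleven.add_one (by decide)
      · exact (sortableBlock_eleven.add_one (by decide)).add_one (by decide)
      · exact sortableBlock_fourteen
    · obtain ⟨m, rfl⟩ : ∃ m, n = m + 11 := ⟨n - 11, by omega⟩
      have := (ih m (by omega) (by omega)).add_eleven (by omega)
      rwa [show (7 * m + 10) / 11 + 7 = (7 * (m + 11) + 10) / 11 by omega] at this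

theorem solvable_univ (n : ℕ) :
    Solvable (Set.univ : Set (Finset (Fin n))) ((7 * n + 10) / 11) := by
  by_cases hn : 4 ≤ n
  · exact (sortableBlock_of_four_le n hn).solvable_univ
  · obtain rfl | rfl | rfl | rfl : n = 0 ∨ n = 1 ∨ n = 2 ∨ n = 3 := by omega
    · exact (solvable_of_forall_constant (by decide)).mono subset_rfl (Nat.zero_le _)
    · exact (solvable_of_forall_constant (by decide)).mono subset_rfl (Nat.zero_le _)
    · exact (SortableBlock.of_checkList (by decide) checkList_two).solvable_univ
    · exact (SortableBlock.of_checkList (by decide) checkList_three).solvable_univ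

theorem mem_sufficient_of_solvable {n k : ℕ} (h : Solvable (Set.univ : Set (Finset (Fin n))) k) :
    k ∈ sufficient n := by
  obtain ⟨s, hs, h⟩ := h
  refine ⟨s, fun w ⟨a, b, ha, hab, hw⟩ => ?_, hs⟩
  have hw' : w = fun i => if i ∈ univ.filter (fun i => w i = b) then b else a := by
    funext i
    obtain h | h := hw i <;> simp [h, hab.ne]
  rw [hw']
  exact h _ (Set.mem_univ _) a b ha hab

/-! ### The lower bound -/

/-- The sets which a strategy may announce. -/
def Strategy.announcements {n : ℕ} : Strategy n → Finset (Finset (Fin n))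
  | .announce heavy => {heavy}
  | .weigh _ _ _ sLt sEq sGt => sLt.announcements ∪ sEq.announcements ∪ sGt.announcements

theorem Strategy.run_mem_announcements {n : ℕ} (w : Fin n → ℝ) (s : Strategy n) :
    s.run w ∈ s.announcements := by
  induction s with
  | announce => simp [run, announcements]
  | weigh =>
    simp only [run, announcements, mem_union]
    split_ifs <;> simp [*]

theorem Strategy.card_announcements_le {n : ℕ} (s : Strategy n) :
    #s.announcements ≤ 3 ^ s.weighings := by
  induction s with
  | announce => simp [weighings, announcements]
  | weigh A B _ l e g hl he hg =>
    simp only [weighings, announcements]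
    set k := max l.weighings (max e.weighings g.weighings)
    have hp {i : ℕ} (hi : i ≤ k) : 3 ^ i ≤ 3 ^ k := Nat.pow_le_pow_right (by decide) hi
    have h1 := hp (le_max_left _ _)
    have h2 := hp ((le_max_left _ _).trans (le_max_right _ _))
    have h3 := hp ((le_max_right _ _).trans (le_max_right _ _))
    calc _ ≤ #l.announcements + #e.announcements + #g.announcements :=
          (card_union_le _ _).trans (Nat.add_le_add_right (card_union_le _ _) _)
      _ ≤ 3 ^ k + 3 ^ k + 3 ^ k := by omega
      _ = 3 ^ (k + 1) := by ring

/-- The announcement determines which pairs of coins differ and in which direction. A set that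
misses some coin is recovered from this relation as the set of coins heavier than some other one. -/
theorem SortedBy.eq_of_ne_univ {n : ℕ} {A H K : Finset (Fin n)} {a b : ℝ} (hab : a < b)
    (hH : SortedBy A fun i => if i ∈ H then b else a) (hK : SortedBy A fun i => if i ∈ K then b else a)
    (hH1 : H ≠ univ) (hK1 : K ≠ univ) : H = K := by
  have hlt (L : Finset (Fin n)) (i j : Fin n) :
      ((if i ∈ L then b else a) < if j ∈ L then b else a) ↔ i ∉ L ∧ j ∈ L := by
    by_cases hi : i ∈ L <;> by_cases hj : j ∈ L <;> simp [hi, hj, hab, hab.le]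
  have key (i j : Fin n) : i ∉ H ∧ j ∈ H ↔ i ∉ K ∧ j ∈ K := by
    rw [← hlt, hH i j, ← hK i j, hlt]
  obtain ⟨i, hi⟩ : ∃ i, i ∉ H := by simpa [eq_univ_iff_forall] using hH1
  obtain ⟨i', hi'⟩ : ∃ i, i ∉ K := by simpa [eq_univ_iff_forall] using hK1
  ext j
  exact ⟨fun h => ((key i j).1 ⟨hi, h⟩).2, fun h => ((key i' j).2 ⟨hi', h⟩).2⟩

theorem two_pow_sub_one_le {n k : ℕ} (h : k ∈ sufficient n) : 2 ^ n - 1 ≤ 3 ^ k := by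
  obtain ⟨s, hs, hk⟩ := h
  have hsort (H : Finset (Fin n)) : SortedBy (s.run fun i => if i ∈ H then (2 : ℝ) else 1)
      fun i => if i ∈ H then (2 : ℝ) else 1 :=
    hs _ ⟨1, 2, one_pos, one_lt_two, fun i => by by_cases h : i ∈ H <;> simp [h]⟩
  calc 2 ^ n - 1 = #((univ : Finset (Finset (Fin n))).erase univ) := by simp
    _ ≤ #s.announcements := by
      refine card_le_card_of_injOn (fun H => s.run fun i => if i ∈ H then (2 : ℝ) else 1)
        (fun H _ => s.run_mem_announcements _) fun H hH K hK hHK => ?_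
      exact SortedBy.eq_of_ne_univ one_lt_two (hsort H) ((show s.run _ = s.run _ from hHK) ▸ hsort K) (by simpa using hH)
        (by simpa using hK)
    _ ≤ 3 ^ s.weighings := s.card_announcements_le
    _ ≤ 3 ^ k := Nat.pow_le_pow_right (by decide) hk

end CoinSorting

theorem proposition2 (n : ℕ) (hn : 1 ≤ n) :
    IsLeast (CoinSorting.sufficient n) (CoinSorting.gBar n) ∧
      ⌈Real.logb 3 ((2 : ℝ) ^ n - 1)⌉ ≤ (CoinSorting.gBar n : ℤ) ∧
      (CoinSorting.gBar n : ℤ) ≤ ⌈(7 * (n : ℝ)) / 11⌉ := by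
  have hmem := CoinSorting.mem_sufficient_of_solvable (CoinSorting.solvable_univ n)
  have hleast : IsLeast (CoinSorting.sufficient n) (CoinSorting.gBar n) :=
    ⟨Nat.sInf_mem ⟨_, hmem⟩, fun k hk => Nat.sInf_le hk⟩
  refine ⟨hleast, ?_, ?_⟩
  · have h := CoinSorting.two_pow_sub_one_le hleast.1
    have h2 : 2 ≤ 2 ^ n := Nat.le_self_pow (by omega) 2
    have hcast : ((2 ^ n - 1 : ℕ) : ℝ) = (2 : ℝ) ^ n - 1 := by
      rw [Nat.cast_sub (by omega)]
      simp
    have hpos : (0 : ℝ) < (2 : ℝ) ^ n - 1 := by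
      rw [← hcast, Nat.cast_pos]
      omega
    rw [Int.ceil_le, Int.cast_natCast, Real.logb_le_iff_le_rpow (by norm_num) hpos,
      Real.rpow_natCast, ← hcast]
    exact_mod_cast h
  · have h := hleast.2 hmem
    have hceil := Int.le_ceil ((7 * (n : ℝ)) / 11)
    rw [div_le_iff₀ (by norm_num)] at hceil
    have : 7 * (n : ℤ) ≤ ⌈(7 * (n : ℝ)) / 11⌉ * 11 := by exact_mod_cast hceil
    -- Here `gBar n ≤ (7 * n + 10) / 11` from `solvable_univ` meets `7 * n ≤ 11 * ⌈7n/11⌉`.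
    omega
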